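/- Let $\mathrm{maj}:\{0,1\}^3\to\{0,1\}$ be the majority function and let $D_2=\langle \mathrm{maj}\rangle$ be the clone it generates (all compositions of $\mathrm{maj}$ and projections). Operations act coefficient-wise on vectors of $\{0,1\}^n$; for a set $\mathcal S\subseteq\{0,1\}^n$, let $\mathcal S^0=\mathcal S$, let $\mathcal S^{i+1}$ be $\mathcal S^i$ together with all $f(v^1,\dots,v^t)$ where $f\in D_2$ has arity $t$ and $v^1,\dots,v^t\in\mathcal S^i$, and let $Cl_{D_2}(\mathcal S)=\bigcup_i \mathcal S^i$. The problem $\textsc{EnumClosure}_{D_2}$ is: given $m$, $n$ and a list of $m$ vectors of $\{0,1\}^n$ forming the set $\mathcal S$, output every element of $Cl_{D_2}(\mathcal S)$ exactly once, and nothing else. Proposition. (1) $\textsc{EnumClosure}_{D_2}$ can be solved with delay $O(n)$ after a polynomial precomputation. That is, there are a single program for a random access machine (with addition, subtraction, multiplication, indirect addressing, output registers and an output instruction, each instruction costing one step), polynomials $p,q$ and a constant $C$ such that for all $m,n\ge 0$ and every instance $\mathcal S$ of $m$ vectors of size $n$ the program solves the problem and halts; the first output is made within $p(m+n)$ steps,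 any two consecutive outputs are at most $C(n+1)$ steps apart, the program halts at most $C(n+1)$ steps after the last output (within $p(m+n)$ steps if there is no output), and all registers hold at all times natural numbers at most $q(m+n)$. (2) For every $m,n\ge 0$ and every such $\mathcal S$, $Cl_{D_2}(\mathcal S)$ is the set of models of a 2CNF formula in $n$ variables, i.e. a conjunction of clauses with at most two literals each. -/

import Mathlib

/-! ## Coefficient-wise operations, clones, closures -/

/-- An operation of some finite arity `t` on `D`: a function from `D ^ t` to `D`. -/
abbrev Operation (D : Type) : Type := (t : ℕ) × ((Fin t → D) → D)

/-- The coefficient-wise action of an operation on a tuple of vectors of the same size. -/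
def Operation.onVectors {D : Type} {n : ℕ} (f : Operation D) (v : Fin f.1 → Fin n → D) :
    Fin n → D :=
  fun i => f.2 (fun k => v k i)

/-- The clone generated by `F`: all operations obtained by composition from the operations in `F`
and the projections. -/
inductive Clone {D : Type} (F : Set (Operation D)) : Set (Operation D)
  | base (f : Operation D) (hf : f ∈ F) : Clone F f
  | proj (t : ℕ) (k : Fin t) : Clone F ⟨t, fun x => x k⟩
  | comp (s t : ℕ) (f : (Fin s → D) → D) (g : Fin s → (Fin t → D) → D)
      (hf : Clone F ⟨s, f⟩) (hg : ∀ k, Clone F ⟨t, g k⟩) :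
      Clone F ⟨t, fun x => f (fun k => g k x)⟩

/-- One round of saturation: add all images of tuples of elements of `X` by operations in `F`. -/
def saturate {D : Type} {n : ℕ} (F : Set (Operation D)) (X : Set (Fin n → D)) :
    Set (Fin n → D) :=
  {w | ∃ f ∈ F, ∃ v : Fin f.1 → Fin n → D, (∀ k, v k ∈ X) ∧ w = f.onVectors v} ∪ X

/-- The closure of `S` by the operations of `F`: the union of all rounds of saturation. -/
def Cl {D : Type} {n : ℕ} (F : Set (Operation D)) (S : Set (Fin n → D)) : Set (Fin n → D) :=
  ⋃ i : ℕ, (saturate F)^[i] S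

/-- The majority of three booleans. -/
def maj : Operation Bool := ⟨3, fun x => (x 0 && x 1) || (x 0 && x 2) || (x 1 && x 2)⟩

/-- The clone of boolean operations generated by the majority. -/
def D₂ : Set (Operation Bool) := Clone {maj}

/-! ## Random access machines with output -/

namespace RAM

/-- Instructions of a random access machine. The machine has working registers `R 0, R 1, …`,
output registers `Out 0, Out 1, …`, all holding natural numbers, and read-only access to its
input word `In`. -/
inductive Instr : Type
  /-- `R a := c` -/
  | const (a c : ℕ)
  /-- `R a := R b` -/
  | move (a b : ℕ)
  /-- `R a := R b + R c` -/
  | add (a b c : ℕ)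
  /-- `R a := R b - R c` (zero if `R b < R c`) -/
  | sub (a b c : ℕ)
  /-- `R a := R b * R c` -/
  | mul (a b c : ℕ)
  /-- `R a := R (R b)` -/
  | load (a b : ℕ)
  /-- `R (R a) := R b` -/
  | store (a b : ℕ)
  /-- `R a := In (R b)` (zero beyond the end of the input) -/
  | read (a b : ℕ)
  /-- `Out (R a) := R b` -/
  | put (a b : ℕ)
  /-- go to instruction number `l` -/
  | jump (l : ℕ)
  /-- go to instruction number `l` if `R a = 0` -/
  | jumpZero (a l : ℕ)
  /-- output the word `Out 0, …, Out (R a - 1)` as one solution -/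
  | output (a : ℕ)
  /-- stop -/
  | halt

/-- A program is a finite list of instructions, numbered from `0`. -/
abbrev Program : Type := List Instr

/-- A configuration: the number of the next instruction and the contents of the registers. -/
structure Config : Type where
  pc : ℕ
  reg : ℕ → ℕ
  out : ℕ → ℕ

/-- The machine starts at instruction `0` with all registers zero. -/
def Config.init : Config := ⟨0, fun _ => 0, fun _ => 0⟩

/-- The effect of executing one instruction on the input word `w`. -/
def Instr.exec (w : List ℕ) (c : Config) : Instr → Config
  | .const a k => { c with pc := c.pc + 1, reg := Function.update c.reg a k }
  | .move a b => { c with pc := c.pc + 1, reg := Function.update c.reg a (c.reg b) }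
  | .add a b d => { c with pc := c.pc + 1, reg := Function.update c.reg a (c.reg b + c.reg d) }
  | .sub a b d => { c with pc := c.pc + 1, reg := Function.update c.reg a (c.reg b - c.reg d) }
  | .mul a b d => { c with pc := c.pc + 1, reg := Function.update c.reg a (c.reg b * c.reg d) }
  | .load a b => { c with pc := c.pc + 1, reg := Function.update c.reg a (c.reg (c.reg b)) }
  | .store a b => { c with pc := c.pc + 1, reg := Function.update c.reg (c.reg a) (c.reg b) }
  | .read a b => { c with pc := c.pc + 1, reg := Function.update c.reg a (w.getD (c.reg b) 0) }
  | .put a b => { c with pc := c.pc + 1, out := Function.update c.out (c.reg a) (c.reg b) }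
  | .jump l => { c with pc := l }
  | .jumpZero a l => { c with pc := if c.reg a = 0 then l else c.pc + 1 }
  | .output _ => { c with pc := c.pc + 1 }
  | .halt => c

/-- The instruction to be executed next; running past the end of the program means `halt`. -/
def Program.next (P : Program) (c : Config) : Instr := P.getD c.pc .halt

/-- The configuration reached from the initial one after `t` steps on the input word `w`. -/
def Program.run (P : Program) (w : List ℕ) : ℕ → Config
  | 0 => Config.init
  | t + 1 => (P.next (P.run w t)).exec w (P.run w t)

/-- The word that an instruction outputs when it is executed, if any. -/
def Instr.emit (c : Config) : Instr → Option (List ℕ)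
  | .output a => some ((List.range (c.reg a)).map c.out)
  | _ => none

/-- The list, in order, of all pairs `(t, u)` such that the word `u` is output by the step leading
from time `t` to time `t + 1`, where `t < T`. -/
def Program.outputs (P : Program) (w : List ℕ) (T : ℕ) : List (ℕ × List ℕ) :=
  (List.range T).filterMap fun t =>
    ((P.next (P.run w t)).emit (P.run w t)).map fun u => (t, u)

/-- On the input word `w`, the program `P` halts after having output every word of `A` exactly once
and nothing else. The first output occurs after at most `pre` steps, at most `delay` steps separate
two consecutive outputs, and also the last output and the end of the computation (which comes after
at most `pre` steps if there is no output). All numbers ever held by a register are at most `word`,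
so that every step is an operation on numbers of `O(log word)` bits. -/
def Program.Enumerates (P : Program) (w : List ℕ) (A : Set (List ℕ)) (pre delay word : ℕ) :
    Prop :=
  ∃ T : ℕ,
    P.next (P.run w T) = .halt ∧
    ((P.outputs w T).map Prod.snd).Nodup ∧
    (∀ u : List ℕ, u ∈ (P.outputs w T).map Prod.snd ↔ u ∈ A) ∧
    (∀ t ∈ ((P.outputs w T).map Prod.fst ++ [T]).head?, t ≤ pre) ∧
    ((P.outputs w T).map Prod.fst ++ [T]).IsChain (fun t t' => t' ≤ t + delay) ∧
    ∀ t ≤ T, ∀ a : ℕ, (P.run w t).reg a ≤ word ∧ (P.run w t).out a ≤ word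

end RAM

/-! ## The enumeration problem of a closure -/

/-- A boolean vector as a word. -/
def encodeVector {n : ℕ} (v : Fin n → Bool) : List ℕ := List.ofFn fun j => (v j).toNat

/-- The input word of an instance with `m` vectors of size `n`: the numbers `m` and `n`, followed by
the vectors. -/
def encodeInstance {m n : ℕ} (S : Fin m → Fin n → Bool) : List ℕ :=
  m :: n :: (List.ofFn fun i => encodeVector (S i)).flatten

/-- The solutions of the problem of enumerating the closure by `F`: the vectors of the closure of
the given set. -/
def enumClosure (F : Set (Operation Bool)) {m n : ℕ} (S : Fin m → Fin n → Bool) :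
    Set (List ℕ) :=
  encodeVector '' Cl F (Set.range S)

/-! ## A structured language and its compilation to the random access machine -/

namespace RAM

/-! Majority preserves every binary relation on the booleans, so each vector of the closure has all
its projections to two coordinates among those of the given vectors. For a nonempty instance the
converse is the Baker–Pixley argument (`exists_mem_Cl_eqOn`): interpolants on three smaller sets of
coordinates are combined by one majority. Hence `Cl_eq_pairClosure`, and forbidding each missing
pair of values by one clause gives the 2CNF. An empty instance has empty closure because no
operation of the clone is nullary.

For the enumeration, a `Branch` keeps one known solution and a set of free coordinates, each of
which can still be flipped. Flipping at a free `x` forces some other values, and these can be read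
off the table of compatible pairs in a single pass: the table comes from actual vectors, so a forced
value is shared by all vectors with the new value at `x`, and no further propagation is needed
(`Good.flip_mem`). One pass therefore yields a new solution and splits what remains into two
disjoint branches, according to the value at `x` (`Good.mem_todo_iff`). Branches without free
coordinates are never stacked, so every branch taken from the stack produces an output at once.
`Lists.spec` shows that nothing is missed or repeated, and `Ok` bounds the height of the stack by
`n`.

The algorithm is written in a small structured language. `Cmd.compile_sound` transfers a
precondition calculus with step counts to the machine. The step between two outputs has no nested
loops, hence cost `O(n + 1)` (`Cmd.cost_le_of_unnested`); the cost of the table is polynomial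
(`Cmd.exists_polynomial_cost`). -/

/-- Arithmetic expressions over scalar variables, arrays and the input word. -/
inductive Expr : Type
  | const (c : ℕ)
  | var (x : ℕ)
  | add (a b : Expr)
  | sub (a b : Expr)
  | mul (a b : Expr)
  | get (k : ℕ) (a : Expr)
  | inp (a : Expr)

/-- The states of the structured language. -/
structure Store : Type where
  var : ℕ → ℕ
  mem : ℕ → ℕ → ℕ
  out : ℕ → ℕ

/-! ### Updates of stores and bounds on their contents. -/

namespace Store

/-- Assignment to a scalar variable. -/
def setVar (σ : Store) (x v : ℕ) : Store := { σ with var := Function.update σ.var x v }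

/-- Assignment to an array cell. -/
def setMem (σ : Store) (k i v : ℕ) : Store :=
  { σ with mem := fun k' i' => if k' = k ∧ i' = i then v else σ.mem k' i' }

/-- Assignment to an output register. -/
def setOut (σ : Store) (i v : ℕ) : Store := { σ with out := Function.update σ.out i v }

/-- All numbers in the store are at most `β`. -/
structure Bdd (β : ℕ) (σ : Store) : Prop where
  var : ∀ x, σ.var x ≤ β
  mem : ∀ k i, σ.mem k i ≤ β
  out : ∀ i, σ.out i ≤ β

theorem Bdd.setVar {β : ℕ} {σ : Store} (h : σ.Bdd β) (x : ℕ) {v : ℕ} (hv : v ≤ β) :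
    (σ.setVar x v).Bdd β := by
  refine ⟨fun y => ?_, h.mem, h.out⟩
  by_cases hy : y = x
  · simp [Store.setVar, hy, hv]
  · simpa [Store.setVar, hy] using h.var y

theorem Bdd.setMem {β : ℕ} {σ : Store} (h : σ.Bdd β) (k i : ℕ) {v : ℕ} (hv : v ≤ β) :
    (σ.setMem k i v).Bdd β := by
  refine ⟨h.var, fun k' i' => ?_, h.out⟩
  simp only [Store.setMem]
  split_ifs
  · exact hv
  · exact h.mem k' i'

theorem Bdd.setOut {β : ℕ} {σ : Store} (h : σ.Bdd β) (i : ℕ) {v : ℕ} (hv : v ≤ β) :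
    (σ.setOut i v).Bdd β := by
  refine ⟨h.var, h.mem, fun y => ?_⟩
  by_cases hy : y = i
  · simp [Store.setOut, hy, hv]
  · simpa [Store.setOut, hy] using h.out y

end Store

namespace Expr

/-- The value of an expression. -/
def val (w : List ℕ) (σ : Store) : Expr → ℕ
  | const c => c
  | var x => σ.var x
  | add a b => a.val w σ + b.val w σ
  | sub a b => a.val w σ - b.val w σ
  | mul a b => a.val w σ * b.val w σ
  | get k a => σ.mem k (a.val w σ)
  | inp a => w.getD (a.val w σ) 0

/-- An exponent bounding the numbers that occur in the evaluation. -/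
def size : Expr → ℕ
  | const c => c + 1
  | var _ => 1
  | add a b => a.size + b.size
  | sub a b => a.size + b.size
  | mul a b => a.size + b.size
  | get k a => 5 + a.size + (41 + k)
  | inp a => a.size

/-- The code that evaluates an expression into register `d`, using only registers from `d` on:
array `k` has its cell `i` in register `40 + 4 * i + k`. -/
def compile : Expr → ℕ → List Instr
  | const c, d => [.const d c]
  | var x, d => [.move d x]
  | add a b, d => a.compile d ++ (b.compile (d + 1) ++ [.add d d (d + 1)])
  | sub a b, d => a.compile d ++ (b.compile (d + 1) ++ [.sub d d (d + 1)])
  | mul a b, d => a.compile d ++ (b.compile (d + 1) ++ [.mul d d (d + 1)])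
  | get k a, d => a.compile d ++
      [.const (d + 1) 4, .mul d d (d + 1), .const (d + 1) (40 + k), .add d d (d + 1), .load d d]
  | inp a, d => a.compile d ++ [.read d d]

/-- The number of instructions of the code of an expression. -/
def len : Expr → ℕ
  | const _ => 1
  | var _ => 1
  | add a b => a.len + (b.len + 1)
  | sub a b => a.len + (b.len + 1)
  | mul a b => a.len + (b.len + 1)
  | get _ a => a.len + 5
  | inp a => a.len + 1

/-- The code for `e` into register `d` uses only existing variables, arrays and scratch
registers. -/
def wf : Expr → ℕ → Bool
  | const _, d => d < 40
  | var x, d => x < 20 && d < 40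
  | add a b, d => a.wf d && b.wf (d + 1)
  | sub a b, d => a.wf d && b.wf (d + 1)
  | mul a b, d => a.wf d && b.wf (d + 1)
  | get k a, d => a.wf d && k < 4 && d + 1 < 40
  | inp a, d => a.wf d

theorem length_compile (e : Expr) (d : ℕ) : (e.compile d).length = e.len := by
  induction e generalizing d <;> simp_all [compile, len]

theorem one_le_size (e : Expr) : 1 ≤ e.size := by
  induction e <;> simp only [size] <;> omega

theorem wf_lt {e : Expr} {d : ℕ} (h : e.wf d) : d < 40 := by
  induction e generalizing d <;> simp_all [wf]

end Expr

/-- A sum of two numbers that are at least 2 is at most their product. This lets `Expr.size` add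
exponents for sums just as for products. -/
theorem add_le_pow_add {M x y a b : ℕ} (hM : 2 ≤ M) (ha : 1 ≤ a) (hb : 1 ≤ b) (hx : x ≤ M ^ a)
    (hy : y ≤ M ^ b) : x + y ≤ M ^ (a + b) := by
  have h1 : 2 ≤ M ^ a := hM.trans (Nat.le_self_pow (by omega) M)
  have h2 : 2 ≤ M ^ b := hM.trans (Nat.le_self_pow (by omega) M)
  rw [pow_add]
  nlinarith

theorem mul_le_pow_add {M x y a b : ℕ} (hx : x ≤ M ^ a) (hy : y ≤ M ^ b) :
    x * y ≤ M ^ (a + b) := by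
  rw [pow_add]
  exact Nat.mul_le_mul hx hy

theorem const_le_pow {M : ℕ} (hM : 2 ≤ M) (c : ℕ) : c ≤ M ^ (c + 1) :=
  ((Nat.lt_pow_self (n := c) (by omega : 1 < M)).le).trans
    (Nat.pow_le_pow_right (by omega) (by omega))

/-- Intermediate values may exceed the bound `β` on stored numbers; this is the polynomial bound
that the scratch registers obey instead. -/
theorem Expr.val_le {w : List ℕ} {σ : Store} {β : ℕ} (hw : ∀ a, w.getD a 0 ≤ β) (hσ : σ.Bdd β)
    (e : Expr) : e.val w σ ≤ (β + 2) ^ e.size := by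
  have h2 : 2 ≤ β + 2 := by omega
  have key : ∀ (s x : ℕ), 1 ≤ s → x ≤ β → x ≤ (β + 2) ^ s := fun s x hs hx =>
    (by omega : x ≤ β + 2).trans (Nat.le_self_pow (by omega) _)
  induction e with
  | const c => exact const_le_pow h2 c
  | var x => exact key _ _ le_rfl (hσ.var x)
  | add a b iha ihb => exact add_le_pow_add h2 a.one_le_size b.one_le_size iha ihb
  | sub a b iha ihb =>
    exact (Nat.sub_le _ _).trans (iha.trans (Nat.pow_le_pow_right (by omega) (by simp [size])))
  | mul a b iha ihb => exact mul_le_pow_add iha ihb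
  | get k a ih => exact key _ _ (Expr.one_le_size (.get k a)) (hσ.mem _ _)
  | inp a ih => exact key _ _ (Expr.one_le_size (.inp a)) (hw _)

/-! ### Silent runs of the machine -/

/-- All registers hold numbers that are at most `B`. -/
def Config.Bdd (B : ℕ) (c : Config) : Prop := (∀ a, c.reg a ≤ B) ∧ ∀ a, c.out a ≤ B

/-- `k` steps lead from `c` to `c'`, without any output and with bounded registers (before every
step). -/
inductive Silent (P : Program) (w : List ℕ) (B : ℕ) : ℕ → Config → Config → Prop
  | refl (c : Config) : Silent P w B 0 c c
  | step {k : ℕ} {c c' : Config} (hB : c.Bdd B) (he : (P.next c).emit c = none)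
      (h : Silent P w B k ((P.next c).exec w c) c') : Silent P w B (k + 1) c c'

theorem Silent.trans {P : Program} {w : List ℕ} {B k l : ℕ} {c c' c'' : Config}
    (h : Silent P w B k c c') (h' : Silent P w B l c' c'') : Silent P w B (k + l) c c'' := by
  induction h with
  | refl c => simpa using h'
  | @step k c c' hB he h ih =>
    rw [Nat.add_right_comm]
    exact .step hB he (ih h')

theorem Silent.one {P : Program} {w : List ℕ} {B : ℕ} {c : Config} (i : Instr) (hi : P.next c = i)
    (hB : c.Bdd B) (he : i.emit c = none) : Silent P w B 1 c (i.exec w c) := by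
  subst hi
  exact .step hB he (.refl _)

/-- The instructions `is` stand in the program `P` from position `p` on. -/
def CodeAt (P : Program) (p : ℕ) (is : List Instr) : Prop :=
  ∃ l r, P = l ++ is ++ r ∧ l.length = p

theorem CodeAt.left {P : Program} {p : ℕ} {is js : List Instr} (h : CodeAt P p (is ++ js)) :
    CodeAt P p is := by
  obtain ⟨l, r, rfl, hl⟩ := h
  exact ⟨l, js ++ r, by simp, hl⟩

theorem CodeAt.right {P : Program} {p : ℕ} {is js : List Instr} (h : CodeAt P p (is ++ js)) :
    CodeAt P (p + is.length) js := by
  obtain ⟨l, r, rfl, hl⟩ := h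
  exact ⟨l ++ is, r, by simp, by simp [hl]⟩

theorem CodeAt.tail {P : Program} {p : ℕ} {i : Instr} {is : List Instr}
    (h : CodeAt P p (i :: is)) : CodeAt P (p + 1) is :=
  CodeAt.right (is := [i]) h

theorem CodeAt.next {P : Program} {p : ℕ} {i : Instr} {is : List Instr}
    (h : CodeAt P p (i :: is)) (reg out : ℕ → ℕ) : P.next ⟨p, reg, out⟩ = i := by
  obtain ⟨l, r, rfl, rfl⟩ := h
  simp [Program.next]

theorem update_le {f : ℕ → ℕ} {B : ℕ} (h : ∀ a, f a ≤ B) (x : ℕ) {v : ℕ} (hv : v ≤ B) (a : ℕ) :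
    Function.update f x v a ≤ B := by
  by_cases ha : a = x
  · simpa [ha] using hv
  · simpa [ha] using h a

/-- The registers represent the store. -/
structure Rel (B : ℕ) (σ : Store) (reg : ℕ → ℕ) : Prop where
  var : ∀ x < 20, reg x = σ.var x
  mem : ∀ k < 4, ∀ i, reg (40 + 4 * i + k) = σ.mem k i
  le : ∀ a, reg a ≤ B

/-- Registers 20 to 39 are scratch space and represent nothing. -/
theorem Rel.congr {B : ℕ} {σ : Store} {reg reg' : ℕ → ℕ} (h : Rel B σ reg)
    (h' : ∀ r, r < 20 ∨ 40 ≤ r → reg' r = reg r) (hB : ∀ a, reg' a ≤ B) : Rel B σ reg' :=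
  ⟨fun x hx => (h' x (.inl hx)).trans (h.var x hx),
    fun k hk i => (h' _ (.inr (by omega))).trans (h.mem k hk i), hB⟩

theorem Silent.set {P : Program} {w : List ℕ} {B p : ℕ} {i : Instr} {is : List Instr}
    (hc : CodeAt P p (i :: is)) {reg out : ℕ → ℕ} (hreg : ∀ a, reg a ≤ B) (hout : ∀ a, out a ≤ B)
    (d : ℕ) {v : ℕ} (he : i.emit ⟨p, reg, out⟩ = none)
    (hx : i.exec w ⟨p, reg, out⟩ = ⟨p + 1, Function.update reg d v, out⟩) :
    Silent P w B 1 ⟨p, reg, out⟩ ⟨p + 1, Function.update reg d v, out⟩ := by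
  rw [← hx]
  exact .one i (hc.next reg out) ⟨hreg, hout⟩ he

/-- The code that replaces an index into array `k` by the number of the register holding that
cell. -/
theorem Silent.address {P : Program} {w : List ℕ} {B p d k v : ℕ} {is : List Instr}
    (hc : CodeAt P p ([.const (d + 1) 4, .mul d d (d + 1), .const (d + 1) (40 + k),
      .add d d (d + 1)] ++ is)) {reg out : ℕ → ℕ} (hreg : ∀ a, reg a ≤ B) (hout : ∀ a, out a ≤ B)
    (hv : reg d = v) (h4 : 4 ≤ B) (hB : 40 + 4 * v + k ≤ B) :
    ∃ reg', Silent P w B 4 ⟨p, reg, out⟩ ⟨p + 4, reg', out⟩ ∧ reg' d = 40 + 4 * v + k ∧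
      (∀ r, r ≠ d → r ≠ d + 1 → reg' r = reg r) ∧ ∀ a, reg' a ≤ B := by
  have hd : d ≠ d + 1 := by omega
  have t1 := Silent.set (w := w) (v := 4) hc hreg hout (d + 1) rfl rfl
  have L1 := update_le hreg (d + 1) h4
  have t2 := Silent.set (w := w) (v := v * 4) hc.tail L1 hout d rfl (by simp [Instr.exec, hv])
  have L2 := update_le L1 d (by omega : v * 4 ≤ B)
  have t3 := Silent.set (w := w) (v := 40 + k) hc.tail.tail L2 hout (d + 1) rfl rfl
  have L3 := update_le L2 (d + 1) (by omega : 40 + k ≤ B)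
  have t4 := Silent.set (w := w) (v := 40 + 4 * v + k) hc.tail.tail.tail L3 hout d rfl
    (by simp [Instr.exec]; ring_nf)
  refine ⟨_, t1.trans (t2.trans (t3.trans t4)), Function.update_self .., fun r h1 h2 => ?_,
    update_le L3 d hB⟩
  simp [h1, h2]

/-- With `M = β + 2`, the bounds `4 ≤ M ^ 5` and `40 + k ≤ M ^ (41 + k)` account for the exponent
that `Expr.size` gives to an array access. -/
theorem address_le {B β s k v : ℕ} (hv : v ≤ (β + 2) ^ s) (hs : 1 ≤ s)
    (hB : (β + 2) ^ (5 + s + (41 + k)) ≤ B) : 4 ≤ B ∧ 40 + 4 * v + k ≤ B := by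
  have h2 : 2 ≤ β + 2 := by omega
  have b4 : 4 ≤ (β + 2) ^ 5 := const_le_pow h2 4
  have b40 : 40 + k ≤ (β + 2) ^ (41 + k) := by
    rw [show 41 + k = 40 + k + 1 by omega]; exact const_le_pow h2 (40 + k)
  have h := (add_le_pow_add h2 (by omega) (by omega) (mul_le_pow_add b4 hv) b40).trans hB
  omega

/-- Evaluation of an expression by its code. -/
theorem Expr.compile_sound {P : Program} {w : List ℕ} {β B : ℕ} (hw : ∀ a, w.getD a 0 ≤ β)
    {σ : Store} (hσ : σ.Bdd β) {out : ℕ → ℕ} (hout : ∀ a, out a ≤ B) (e : Expr) :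
    ∀ (d p : ℕ) (reg : ℕ → ℕ), e.wf d → 20 ≤ d → (β + 2) ^ e.size ≤ B →
      CodeAt P p (e.compile d) → Rel B σ reg →
      ∃ reg', Silent P w B e.len ⟨p, reg, out⟩ ⟨p + e.len, reg', out⟩ ∧ reg' d = e.val w σ ∧
        (∀ r, r < d ∨ 40 ≤ r → reg' r = reg r) ∧ Rel B σ reg' := by
  have mono : ∀ {s t : ℕ}, (β + 2) ^ t ≤ B → s ≤ t → (β + 2) ^ s ≤ B := fun h hst =>
    (Nat.pow_le_pow_right (by omega) hst).trans h
  -- the common part of the three binary operations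
  have binary : ∀ (a b : Expr) (d p : ℕ) (reg : ℕ → ℕ) (i : Instr) (v : ℕ),
      (∀ (d p : ℕ) (reg : ℕ → ℕ), a.wf d → 20 ≤ d → (β + 2) ^ a.size ≤ B →
        CodeAt P p (a.compile d) → Rel B σ reg →
        ∃ reg', Silent P w B a.len ⟨p, reg, out⟩ ⟨p + a.len, reg', out⟩ ∧ reg' d = a.val w σ ∧
          (∀ r, r < d ∨ 40 ≤ r → reg' r = reg r) ∧ Rel B σ reg') →
      (∀ (d p : ℕ) (reg : ℕ → ℕ), b.wf d → 20 ≤ d → (β + 2) ^ b.size ≤ B →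
        CodeAt P p (b.compile d) → Rel B σ reg →
        ∃ reg', Silent P w B b.len ⟨p, reg, out⟩ ⟨p + b.len, reg', out⟩ ∧ reg' d = b.val w σ ∧
          (∀ r, r < d ∨ 40 ≤ r → reg' r = reg r) ∧ Rel B σ reg') →
      (a.wf d && b.wf (d + 1)) = true → 20 ≤ d → (β + 2) ^ (a.size + b.size) ≤ B →
      CodeAt P p (a.compile d ++ (b.compile (d + 1) ++ [i])) → Rel B σ reg →
      v ≤ B →
      (∀ q reg, reg d = a.val w σ → reg (d + 1) = b.val w σ →
        i.emit ⟨q, reg, out⟩ = none ∧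
          i.exec w ⟨q, reg, out⟩ = ⟨q + 1, Function.update reg d v, out⟩) →
      ∃ reg', Silent P w B (a.len + (b.len + 1)) ⟨p, reg, out⟩
          ⟨p + (a.len + (b.len + 1)), reg', out⟩ ∧ reg' d = v ∧
        (∀ r, r < d ∨ 40 ≤ r → reg' r = reg r) ∧ Rel B σ reg' := by
    intro a b d p reg i v iha ihb hwf hd hB hc hR hv hi
    rw [Bool.and_eq_true] at hwf
    have hd' := Expr.wf_lt hwf.2
    obtain ⟨r1, s1, v1, f1, R1⟩ := iha d p reg hwf.1 hd (mono hB (by omega)) hc.left hR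
    have hc' := hc.right
    rw [length_compile] at hc'
    obtain ⟨r2, s2, v2, f2, R2⟩ :=
      ihb (d + 1) (p + a.len) r1 hwf.2 (by omega) (mono hB (by omega)) hc'.left R1
    have hc'' := hc'.right
    rw [length_compile] at hc''
    -- The code of `b` writes no scratch register below `d + 1`, so the value of `a` survives in
    -- register `d`.
    obtain ⟨he, hx⟩ := hi (p + a.len + b.len) r2 ((f2 d (.inl (by omega))).trans v1) v2
    have s3 := Silent.one (w := w) i (hc''.next r2 out) ⟨R2.le, hout⟩ he
    rw [hx] at s3
    refine ⟨Function.update r2 d v, ?_, Function.update_self .., ?_, ?_⟩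
    · simpa [add_assoc] using s1.trans (s2.trans s3)
    · intro r hr
      rw [Function.update_of_ne (by omega), f2 r (by omega), f1 r hr]
    · refine R2.congr (fun r hr => Function.update_of_ne (by omega) _ _) (update_le R2.le _ hv)
  induction e with
  | const c =>
    intro d p reg hwf hd hB hc hR
    have hd' := Expr.wf_lt hwf
    have hcB : c ≤ B := (Expr.val_le hw hσ (.const c)).trans hB
    refine ⟨_, Silent.one _ (hc.next reg out) ⟨hR.le, hout⟩ rfl, Function.update_self .., ?_, ?_⟩
    · exact fun r hr => Function.update_of_ne (by omega) _ _
    · exact hR.congr (fun r hr => Function.update_of_ne (by omega) _ _) (update_le hR.le _ hcB)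
  | var x =>
    intro d p reg hwf hd hB hc hR
    have hd' := Expr.wf_lt hwf
    simp only [wf, Bool.and_eq_true, decide_eq_true_eq] at hwf
    refine ⟨_, Silent.one _ (hc.next reg out) ⟨hR.le, hout⟩ rfl, ?_, ?_, ?_⟩
    · exact (Function.update_self ..).trans (hR.var x hwf.1)
    · exact fun r hr => Function.update_of_ne (by omega) _ _
    · exact hR.congr (fun r hr => Function.update_of_ne (by omega) _ _)
        (update_le hR.le _ (hR.le x))
  | add a b iha ihb =>
    intro d p reg hwf hd hB hc hR
    refine binary a b d p reg _ _ iha ihb hwf hd hB hc hR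
      ((Expr.val_le hw hσ (.add a b)).trans hB) fun q r h1 h2 => ⟨rfl, ?_⟩
    simp [Instr.exec, h1, h2, val]
  | sub a b iha ihb =>
    intro d p reg hwf hd hB hc hR
    refine binary a b d p reg _ _ iha ihb hwf hd hB hc hR
      ((Expr.val_le hw hσ (.sub a b)).trans hB) fun q r h1 h2 => ⟨rfl, ?_⟩
    simp [Instr.exec, h1, h2, val]
  | mul a b iha ihb =>
    intro d p reg hwf hd hB hc hR
    refine binary a b d p reg _ _ iha ihb hwf hd hB hc hR
      ((Expr.val_le hw hσ (.mul a b)).trans hB) fun q r h1 h2 => ⟨rfl, ?_⟩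
    simp [Instr.exec, h1, h2, val]
  | get k a ih =>
    intro d p reg hwf hd hB hc hR
    simp only [wf, Bool.and_eq_true, decide_eq_true_eq] at hwf
    obtain ⟨⟨hwf, hk⟩, hd'⟩ := hwf
    obtain ⟨r1, s1, v1, f1, R1⟩ := ih d p reg hwf hd (mono hB (by simp only [size]; omega)) hc.left hR
    have c1 := hc.right
    rw [length_compile] at c1
    obtain ⟨B4, Ba⟩ := address_le (Expr.val_le hw hσ a) a.one_le_size hB
    obtain ⟨r2, s2, v2, f2, L2⟩ := Silent.address (is := [.load d d]) (w := w) c1 R1.le hout v1 B4 Ba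
    -- The register of the cell has number at least 40, while `d` and `d + 1` are below 40, so
    -- computing the address did not overwrite it.
    have s3 := Silent.set (w := w) (v := σ.mem k (a.val w σ)) c1.tail.tail.tail.tail L2 hout d rfl
      (by simp [Instr.exec, v2, f2 _ (by omega : 40 + 4 * a.val w σ + k ≠ d)
            (by omega : 40 + 4 * a.val w σ + k ≠ d + 1), R1.mem k hk])
    have hm : σ.mem k (a.val w σ) ≤ B := by rw [← R1.mem k hk]; exact R1.le _
    refine ⟨_, s1.trans (s2.trans s3), Function.update_self .., fun r hr => ?_, ?_⟩
    · rw [Function.update_of_ne (by omega), f2 r (by omega) (by omega), f1 r hr]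
    · refine R1.congr (fun r hr => ?_) (update_le L2 _ hm)
      rw [Function.update_of_ne (by omega), f2 r (by omega) (by omega)]
  | inp a ih =>
    intro d p reg hwf hd hB hc hR
    have hd' := Expr.wf_lt hwf
    obtain ⟨r1, s1, v1, f1, R1⟩ := ih d p reg hwf hd hB hc.left hR
    have c1 := hc.right
    rw [length_compile] at c1
    have t1 := Silent.one (w := w) _ (c1.next r1 out) ⟨R1.le, hout⟩ rfl
    simp only [Instr.exec, v1] at t1
    refine ⟨_, s1.trans t1, Function.update_self .., fun r hr => ?_, ?_⟩
    · rw [Function.update_of_ne (by omega), f1 r hr]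
    · exact R1.congr (fun r hr => Function.update_of_ne (by omega) _ _)
        (update_le R1.le _ ((Expr.val_le hw hσ (.inp a)).trans hB))

end RAM

namespace RAM

/-! ### Commands -/

/-- Commands: assignment to a variable, an array cell, an output register, composition, and the
loop over all `i < R b`, where the body changes neither `i` nor `b`. -/
inductive Cmd : Type
  | assign (x : ℕ) (e : Expr)
  | store (k : ℕ) (a e : Expr)
  | put (a e : Expr)
  | seq (c d : Cmd)
  | loop (i b : ℕ) (c : Cmd)

namespace Cmd

/-- The number of instructions of the code of a command. -/
def len : Cmd → ℕ
  | assign _ e => e.len + 1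
  | store _ a e => a.len + (4 + (e.len + 1))
  | put a e => a.len + (e.len + 1)
  | seq c d => c.len + d.len
  | loop _ _ c => 3 + (c.len + 3)

/-- The code of a command, starting at position `p`. -/
def compile : Cmd → ℕ → List Instr
  | assign x e, _ => e.compile 20 ++ [.move x 20]
  | store k a e, _ => a.compile 20 ++
      ([.const 21 4, .mul 20 20 21, .const 21 (40 + k), .add 20 20 21] ++
        (e.compile 21 ++ [.store 20 21]))
  | put a e, _ => a.compile 20 ++ (e.compile 21 ++ [.put 20 21])
  | seq c d, p => c.compile p ++ d.compile (p + c.len)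
  | loop i b c, p => [.const i 0, .sub 20 b i, .jumpZero 20 (p + (3 + (c.len + 3)))] ++
      (c.compile (p + 3) ++ [.const 20 1, .add i i 20, .jump (p + 1)])

/-- A bound on the number of steps of a command all of whose loops run at most `N` times. -/
def cost (N : ℕ) : Cmd → ℕ
  | assign _ e => e.len + 1
  | store _ a e => a.len + (4 + (e.len + 1))
  | put a e => a.len + (e.len + 1)
  | seq c d => c.cost N + d.cost N
  | loop _ _ c => 3 + N * (c.cost N + 5)

/-- The command uses existing variables, arrays and scratch registers only, and the exponents
bounding its numbers are at most `D`. -/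
def wf (D : ℕ) : Cmd → Bool
  | assign x e => x < 20 && e.wf 20 && e.size ≤ D
  | store k a e => k < 4 && a.wf 20 && e.wf 21 && 5 + a.size + (41 + k) ≤ D && e.size ≤ D
  | put a e => a.wf 20 && e.wf 21 && a.size ≤ D && e.size ≤ D
  | seq c d => c.wf D && d.wf D
  | loop i b c => i < 20 && b < 20 && i != b && c.wf D

/-- A precondition of a command for a postcondition `Q`: every number assigned is at most `β`, and
every loop runs at most `N` times and has an invariant. -/
def wp (w : List ℕ) (β N : ℕ) : Cmd → (Store → Prop) → Store → Prop
  | assign x e, Q, σ => e.val w σ ≤ β ∧ Q (σ.setVar x (e.val w σ))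
  | store k a e, Q, σ => e.val w σ ≤ β ∧ Q (σ.setMem k (a.val w σ) (e.val w σ))
  | put a e, Q, σ => e.val w σ ≤ β ∧ Q (σ.setOut (a.val w σ) (e.val w σ))
  | seq c d, Q, σ => c.wp w β N (d.wp w β N Q) σ
  | loop i b c, Q, σ => ∃ I : ℕ → Store → Prop, σ.var b ≤ N ∧ I 0 (σ.setVar i 0) ∧
      (∀ k < σ.var b, ∀ τ, I k τ → τ.var i = k → τ.var b = σ.var b →
        c.wp w β N (fun τ' => τ'.var i = k ∧ τ'.var b = σ.var b ∧
          I (k + 1) (τ'.setVar i (k + 1))) τ) ∧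
      ∀ τ, I (σ.var b) τ → τ.var i = σ.var b → τ.var b = σ.var b → Q τ

theorem length_compile (c : Cmd) (p : ℕ) : (c.compile p).length = c.len := by
  induction c generalizing p <;> simp_all [compile, len, Expr.length_compile]
  all_goals omega

end Cmd

/-! ### Soundness of the code of commands. -/

theorem Rel.setVar {B : ℕ} {σ : Store} {reg reg' : ℕ → ℕ} (h : Rel B σ reg) {x v : ℕ}
    (hx : x < 20) (hv : v ≤ B)
    (h' : ∀ r, r < 20 ∨ 40 ≤ r → reg' r = reg r) (hB : ∀ a, reg' a ≤ B) :
    Rel B (σ.setVar x v) (Function.update reg' x v) := by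
  have hR := h.congr h' hB
  refine ⟨fun y hy => ?_, fun k hk i => ?_, update_le hB x hv⟩
  · by_cases hyx : y = x
    · simp [Store.setVar, hyx]
    · simpa [Store.setVar, hyx] using hR.var y hy
  · rw [Function.update_of_ne (by omega)]
    exact hR.mem k hk i

/-- For array numbers below 4 the addresses `40 + 4 * i + k` are pairwise distinct and avoid the
variables. -/
theorem Rel.setMem {B : ℕ} {σ : Store} {reg reg' : ℕ → ℕ} (h : Rel B σ reg) {k i v : ℕ}
    (hk : k < 4) (hv : v ≤ B)
    (h' : ∀ r, r < 20 ∨ 40 ≤ r → reg' r = reg r) (hB : ∀ a, reg' a ≤ B) :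
    Rel B (σ.setMem k i v) (Function.update reg' (40 + 4 * i + k) v) := by
  have hR := h.congr h' hB
  refine ⟨fun y hy => ?_, fun k' hk' i' => ?_, update_le hB _ hv⟩
  · rw [Function.update_of_ne (by omega)]
    exact hR.var y hy
  · simp only [Store.setMem]
    split_ifs with hki
    · rw [hki.1, hki.2, Function.update_self]
    · rw [Function.update_of_ne (by omega)]
      exact hR.mem k' hk' i'

/-- The code of a command runs silently, within the cost of the command, and establishes the
postcondition. -/
theorem Cmd.compile_sound {P : Program} {w : List ℕ} {β N B D : ℕ} (hw : ∀ a, w.getD a 0 ≤ β)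
    (hD : 1 ≤ D) (hB : (β + 2) ^ D ≤ B) (c : Cmd) :
    ∀ (Q : Store → Prop) (σ : Store) (p : ℕ) (reg : ℕ → ℕ), c.wf D → CodeAt P p (c.compile p) →
      c.wp w β N Q σ → σ.Bdd β → Rel B σ reg →
      ∃ k ≤ c.cost N, ∃ reg' σ', Silent P w B k ⟨p, reg, σ.out⟩ ⟨p + c.len, reg', σ'.out⟩ ∧
        Q σ' ∧ σ'.Bdd β ∧ Rel B σ' reg' := by
  have hβ : β + 2 ≤ B := (Nat.le_self_pow (by omega) _).trans hB
  have mono : ∀ {s : ℕ}, s ≤ D → (β + 2) ^ s ≤ B := fun hs =>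
    (Nat.pow_le_pow_right (by omega) hs).trans hB
  induction c with
  | assign x e =>
    intro Q σ p reg hwf hc ⟨hv, hQ⟩ hσ hR
    simp only [wf, Bool.and_eq_true, decide_eq_true_eq] at hwf
    obtain ⟨⟨hx, he⟩, hs⟩ := hwf
    have hout : ∀ a, σ.out a ≤ B := fun a => (hσ.out a).trans (by omega)
    obtain ⟨r1, s1, v1, f1, R1⟩ := Expr.compile_sound hw hσ hout e 20 p reg he le_rfl (mono hs)
      hc.left hR
    have c1 := hc.right
    rw [Expr.length_compile] at c1
    have s2 := Silent.set (w := w) (v := e.val w σ) c1 R1.le hout x rfl (by simp [Instr.exec, v1])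
    exact ⟨_, le_rfl, _, σ.setVar x (e.val w σ), s1.trans s2, hQ, hσ.setVar x hv,
      R1.setVar hx (by omega) (fun _ _ => rfl) R1.le⟩
  | store k a e =>
    intro Q σ p reg hwf hc ⟨hv, hQ⟩ hσ hR
    simp only [wf, Bool.and_eq_true, decide_eq_true_eq] at hwf
    obtain ⟨⟨⟨⟨hk, ha⟩, he⟩, hsa⟩, hse⟩ := hwf
    have hout : ∀ a, σ.out a ≤ B := fun a => (hσ.out a).trans (by omega)
    obtain ⟨r1, s1, v1, f1, R1⟩ := Expr.compile_sound hw hσ hout a 20 p reg ha le_rfl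
      (mono (by omega)) hc.left hR
    have c1 := hc.right
    rw [Expr.length_compile] at c1
    obtain ⟨B4, Ba⟩ := address_le (Expr.val_le hw hσ a) a.one_le_size (mono hsa)
    obtain ⟨r2, s2, v2, f2, L2⟩ := Silent.address (w := w) c1 R1.le hout v1 B4 Ba
    have R2 : Rel B σ r2 := R1.congr (fun r hr => f2 r (by omega) (by omega)) L2
    have c2 := c1.right
    obtain ⟨r3, s3, v3, f3, R3⟩ := Expr.compile_sound hw hσ hout e 21 _ r2 he (by omega)
      (mono hse) c2.left R2
    have c3 := c2.right
    rw [Expr.length_compile] at c3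
    have v3' : r3 20 = 40 + 4 * a.val w σ + k := (f3 20 (by omega)).trans v2
    have s4 := Silent.set (w := w) (v := e.val w σ) c3 R3.le hout (40 + 4 * a.val w σ + k) rfl
      (by simp [Instr.exec, v3, v3'])
    refine ⟨_, le_rfl, _, σ.setMem k (a.val w σ) (e.val w σ), s1.trans (s2.trans (s3.trans ?_)), hQ,
      hσ.setMem _ _ hv, R3.setMem hk (by omega) (fun _ _ => rfl) R3.le⟩
    simpa [len, add_assoc, Store.setMem] using s4
  | put a e =>
    intro Q σ p reg hwf hc ⟨hv, hQ⟩ hσ hR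
    simp only [wf, Bool.and_eq_true, decide_eq_true_eq] at hwf
    obtain ⟨⟨⟨ha, he⟩, hsa⟩, hse⟩ := hwf
    have hout : ∀ a, σ.out a ≤ B := fun a => (hσ.out a).trans (by omega)
    obtain ⟨r1, s1, v1, f1, R1⟩ := Expr.compile_sound hw hσ hout a 20 p reg ha le_rfl
      (mono hsa) hc.left hR
    have c1 := hc.right
    rw [Expr.length_compile] at c1
    obtain ⟨r2, s2, v2, f2, R2⟩ := Expr.compile_sound hw hσ hout e 21 _ r1 he (by omega)
      (mono hse) c1.left R1
    have c2 := c1.right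
    rw [Expr.length_compile] at c2
    have v2' : r2 20 = a.val w σ := (f2 20 (by omega)).trans v1
    have s3 := Silent.one (w := w) _ (c2.next r2 σ.out) ⟨R2.le, hout⟩ rfl
    simp only [Instr.exec, v2, v2'] at s3
    refine ⟨_, le_rfl, _, σ.setOut (a.val w σ) (e.val w σ), s1.trans (s2.trans ?_), hQ,
      hσ.setOut _ hv, ⟨R2.var, R2.mem, R2.le⟩⟩
    simpa [len, add_assoc, Store.setOut] using s3
  | seq c d ihc ihd =>
    intro Q σ p reg hwf hc hwp hσ hR
    simp only [wf, Bool.and_eq_true] at hwf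
    obtain ⟨k1, hk1, r1, σ1, s1, h1, hσ1, R1⟩ := ihc _ σ p reg hwf.1 hc.left hwp hσ hR
    have c1 := hc.right
    rw [length_compile] at c1
    obtain ⟨k2, hk2, r2, σ2, s2, h2, hσ2, R2⟩ := ihd _ σ1 _ r1 hwf.2 c1 h1 hσ1 R1
    refine ⟨k1 + k2, by simp only [cost]; omega, r2, σ2, ?_, h2, hσ2, R2⟩
    simpa [len, add_assoc] using s1.trans s2
  | loop i b c ih =>
    intro Q σ p reg hwf hc ⟨I, hN, hI0, hI, hQ⟩ hσ hR
    simp only [wf, Bool.and_eq_true, decide_eq_true_eq, bne_iff_ne] at hwf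
    obtain ⟨⟨⟨hi, hb⟩, hib⟩, hwf⟩ := hwf
    have cbody : CodeAt P (p + 3) (c.compile (p + 3)) := hc.right.left
    have cend := hc.right.right
    rw [length_compile] at cend
    simp only [List.length_cons, List.length_nil] at cend
    -- the rest of the loop from its test on, when `j` rounds are left
    have main : ∀ (j k : ℕ) (τ : Store) (r : ℕ → ℕ), k + j = σ.var b → I k τ → τ.var i = k →
        τ.var b = σ.var b → τ.Bdd β → Rel B τ r →
        ∃ t ≤ 2 + j * (c.cost N + 5), ∃ reg' σ', Silent P w B t ⟨p + 1, r, τ.out⟩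
          ⟨p + (3 + (c.len + 3)), reg', σ'.out⟩ ∧ Q σ' ∧ σ'.Bdd β ∧ Rel B σ' reg' := by
      intro j
      induction j with
      | zero =>
        intro k τ r hk hIk hτi hτb hτ hRτ
        have hout : ∀ a, τ.out a ≤ B := fun a => (hτ.out a).trans (by omega)
        -- The loop test is a truncated difference; it vanishes exactly when the index has reached
        -- the bound.
        have e1 : r b - r i = 0 := by rw [hRτ.var b hb, hRτ.var i hi]; omega
        have t1 := Silent.set (w := w) (v := 0) hc.tail hRτ.le hout 20 rfl
          (by simp [Instr.exec, e1])
        have L1 := update_le hRτ.le 20 (Nat.zero_le B)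
        have t2 := Silent.one (w := w) _ (hc.tail.tail.next (Function.update r 20 0) τ.out)
          ⟨L1, hout⟩ rfl
        simp only [Instr.exec, Function.update_self, if_true] at t2
        have hk' : k = σ.var b := by omega
        subst hk'
        exact ⟨2, by omega, _, τ, t1.trans t2, hQ τ hIk hτi hτb, hτ,
          hRτ.congr (fun r hr => Function.update_of_ne (by omega) _ _) L1⟩
      | succ j ihj =>
        intro k τ r hk hIk hτi hτb hτ hRτ
        have hout : ∀ a, τ.out a ≤ B := fun a => (hτ.out a).trans (by omega)
        have hbB : σ.var b ≤ β := hσ.var b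
        have e1 : r b - r i = j + 1 := by rw [hRτ.var b hb, hRτ.var i hi]; omega
        have t1 := Silent.set (w := w) (v := j + 1) hc.tail hRτ.le hout 20 rfl
          (by simp [Instr.exec, e1])
        have L1 := update_le hRτ.le 20 (by omega : j + 1 ≤ B)
        have t2 := Silent.one (w := w) _ (hc.tail.tail.next (Function.update r 20 (j + 1)) τ.out)
          ⟨L1, hout⟩ rfl
        simp only [Instr.exec, Function.update_self, Nat.succ_ne_zero, if_false] at t2
        have R2 : Rel B τ (Function.update r 20 (j + 1)) :=
          hRτ.congr (fun r hr => Function.update_of_ne (by omega) _ _) L1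
        obtain ⟨t, ht, r3, τ3, s3, ⟨h3i, h3b, h3I⟩, hτ3, R3⟩ :=
          ih _ τ (p + 3) _ hwf cbody (hI k (by omega) τ hIk hτi hτb) hτ R2
        have hout3 : ∀ a, τ3.out a ≤ B := fun a => (hτ3.out a).trans (by omega)
        have t4 := Silent.set (w := w) (v := 1) cend R3.le hout3 20 rfl rfl
        have L4 := update_le R3.le 20 (by omega : 1 ≤ B)
        have t5 := Silent.set (w := w) (v := k + 1) cend.tail L4 hout3 i rfl (by
          have e : Function.update r3 20 1 i = k := by
            rw [Function.update_of_ne (by omega), R3.var i hi, h3i]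
          simp [Instr.exec, e])
        have R5 : Rel B (τ3.setVar i (k + 1))
            (Function.update (Function.update r3 20 1) i (k + 1)) :=
          R3.setVar hi (by omega) (fun r hr => Function.update_of_ne (by omega) _ _) L4
        have t6 := Silent.one (w := w) _ (cend.tail.tail.next
          (Function.update (Function.update r3 20 1) i (k + 1)) τ3.out) ⟨R5.le, hout3⟩ rfl
        simp only [Instr.exec] at t6
        obtain ⟨u, hu, r7, σ7, s7, hQ7, hσ7, R7⟩ := ihj (k + 1) (τ3.setVar i (k + 1)) _ (by omega)
          h3I (by simp [Store.setVar]) (by simp [Store.setVar, hib.symm, h3b])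
          (hτ3.setVar i (by omega)) R5
        refine ⟨1 + (1 + (t + (1 + (1 + (1 + u))))), ?_, r7, σ7,
          t1.trans (t2.trans (s3.trans (t4.trans (t5.trans (t6.trans s7))))), hQ7, hσ7, R7⟩
        -- A round spends two steps on the test and three on the increment and the jump back, whence
        -- the 5 in `Cmd.cost`; the summand 2 pays for the final test.
        rw [Nat.succ_mul]
        omega
    have hout : ∀ a, σ.out a ≤ B := fun a => (hσ.out a).trans (by omega)
    have t1 := Silent.set (w := w) (v := 0) hc hR.le hout i rfl rfl
    have R1 : Rel B (σ.setVar i 0) (Function.update reg i 0) :=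
      hR.setVar hi (by omega) (fun _ _ => rfl) hR.le
    obtain ⟨t, ht, r2, σ2, s2, hQ2, hσ2, R2⟩ := main (σ.var b) 0 (σ.setVar i 0) _ (by omega) hI0
      (by simp [Store.setVar]) (by simp [Store.setVar, hib.symm]) (hσ.setVar i (by omega)) R1
    refine ⟨1 + t, ?_, r2, σ2, t1.trans s2, hQ2, hσ2, R2⟩
    have := Nat.mul_le_mul_right (c.cost N + 5) hN
    simp only [cost]
    omega

end RAM

/-! ## The closure by the majority and its two-element projections -/

/-- Some vector of `S` has the value `a` at `i` and the value `b` at `j`. -/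
def Compat {m n : ℕ} (S : Fin m → Fin n → Bool) (i : Fin n) (a : Bool) (j : Fin n) (b : Bool) :
    Prop :=
  ∃ r, S r i = a ∧ S r j = b

instance {m n : ℕ} (S : Fin m → Fin n → Bool) (i : Fin n) (a : Bool) (j : Fin n) (b : Bool) :
    Decidable (Compat S i a j b) :=
  inferInstanceAs (Decidable (∃ r, S r i = a ∧ S r j = b))

theorem Compat.symm {m n : ℕ} {S : Fin m → Fin n → Bool} {i j : Fin n} {a b : Bool}
    (h : Compat S i a j b) : Compat S j b i a :=
  let ⟨r, hr⟩ := h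
  ⟨r, hr.2, hr.1⟩

/-- The vectors all of whose projections to two coordinates occur in `S`. -/
def pairClosure {m n : ℕ} (S : Fin m → Fin n → Bool) : Set (Fin n → Bool) :=
  {v | ∀ i j, Compat S i (v i) j (v j)}

/-- In each triple at least two of the three positions carry the majority value, and two such sets
of positions always meet. -/
theorem maj_preserves (x y : Fin 3 → Bool) : ∃ k, maj.2 x = x k ∧ maj.2 y = y k := by
  have h : ∀ a b c d e f : Bool, ((a && b || a && c || b && c) = a ∧ (d && e || d && f || e && f) = d) ∨
      ((a && b || a && c || b && c) = b ∧ (d && e || d && f || e && f) = e) ∨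
      ((a && b || a && c || b && c) = c ∧ (d && e || d && f || e && f) = f) := by decide
  rcases h (x 0) (x 1) (x 2) (y 0) (y 1) (y 2) with h | h | h
  exacts [⟨0, h⟩, ⟨1, h⟩, ⟨2, h⟩]

/-- The operations of `D₂` preserve every binary relation on the booleans. -/
theorem clone_maj_preserves {f : Operation Bool} (hf : f ∈ D₂) (Q : Bool → Bool → Prop) :
    ∀ x y : Fin f.1 → Bool, (∀ k, Q (x k) (y k)) → Q (f.2 x) (f.2 y) := by
  induction hf with
  | base f hf =>
    obtain rfl : f = maj := hf
    intro x y h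
    obtain ⟨k, hx, hy⟩ := maj_preserves x y
    rw [hx, hy]
    exact h k
  | proj t k => exact fun x y h => h k
  | comp s t f g hf hg ihf ihg => exact fun x y h => ihf _ _ fun k => ihg k x y h

/-- For fixed `i` and `j`, compatibility is a binary relation on the values, so the clone preserves
it through every round of saturation. -/
theorem Cl_subset_pairClosure {m n : ℕ} (S : Fin m → Fin n → Bool) :
    Cl D₂ (Set.range S) ⊆ pairClosure S := by
  refine Set.iUnion_subset fun i => ?_
  induction i with
  | zero =>
    rintro _ ⟨r, rfl⟩ i j
    exact ⟨r, rfl, rfl⟩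
  | succ k ih =>
    rw [Function.iterate_succ_apply']
    rintro w (⟨f, hf, v, hv, rfl⟩ | hw)
    · exact fun i j => clone_maj_preserves hf (fun a b => Compat S i a j b) _ _
        fun k => ih (hv k) i j
    · exact ih hw

theorem subset_Cl {D : Type} {n : ℕ} (F : Set (Operation D)) (S : Set (Fin n → D)) : S ⊆ Cl F S :=
  Set.subset_iUnion_of_subset 0 subset_rfl

/-- The rounds increase and an operation has finitely many arguments, so all of them lie in a common
round. -/
theorem onVectors_mem_Cl {D : Type} {n : ℕ} {F : Set (Operation D)} {S : Set (Fin n → D)}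
    {f : Operation D} (hf : f ∈ F) {v : Fin f.1 → Fin n → D} (hv : ∀ k, v k ∈ Cl F S) :
    f.onVectors v ∈ Cl F S := by
  have mono : Monotone fun i : ℕ => (saturate F)^[i] S := by
    refine monotone_nat_of_le_succ fun i => ?_
    rw [Function.iterate_succ_apply']
    exact Set.subset_union_right
  choose i hi using fun k => Set.mem_iUnion.mp (hv k)
  refine Set.mem_iUnion.mpr ⟨Finset.univ.sup i + 1, ?_⟩
  rw [Function.iterate_succ_apply']
  exact .inl ⟨f, hf, v, fun k => mono (Finset.le_sup (Finset.mem_univ k)) (hi k), rfl⟩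

/-- The Baker–Pixley theorem for the majority: elements of the closure interpolate every vector
whose two-element projections occur, on every set of coordinates. -/
theorem exists_mem_Cl_eqOn {m n : ℕ} {S : Fin m → Fin n → Bool} (hm : 0 < m) {v : Fin n → Bool}
    (hv : v ∈ pairClosure S) (I : Finset (Fin n)) :
    ∃ u ∈ Cl D₂ (Set.range S), ∀ i ∈ I, u i = v i := by
  induction hc : I.card using Nat.strong_induction_on generalizing I with
  | _ c ih =>
    subst hc
    by_cases h2 : I.card ≤ 2
    · have hsub : ∀ i j : Fin n, I ⊆ {i, j} →
          ∃ u ∈ Cl D₂ (Set.range S), ∀ i ∈ I, u i = v i := by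
        intro i j hI
        obtain ⟨r, hi, hj⟩ := hv i j
        refine ⟨S r, subset_Cl _ _ ⟨r, rfl⟩, fun l hl => ?_⟩
        rcases Finset.mem_insert.mp (hI hl) with rfl | h
        · exact hi
        · rw [Finset.mem_singleton.mp h]; exact hj
      interval_cases h : I.card
      · rw [Finset.card_eq_zero] at h
        -- Only here, with no coordinate to interpolate, does the existence of a vector in the
        -- instance have to be assumed.
        exact ⟨S ⟨0, hm⟩, subset_Cl _ _ ⟨_, rfl⟩, by simp [h]⟩
      · obtain ⟨i, hi⟩ := Finset.card_eq_one.mp h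
        exact hsub i i (by simp [hi])
      · obtain ⟨i, j, -, hij⟩ := Finset.card_eq_two.mp h
        exact hsub i j hij.subset
    · obtain ⟨a, b, c, ha, hb, hc, hab, hac, hbc⟩ :=
        Finset.two_lt_card_iff.mp (not_le.mp h2)
      have step : ∀ x ∈ I, ∃ u ∈ Cl D₂ (Set.range S), ∀ i ∈ I.erase x, u i = v i := fun x hx =>
        ih _ (Finset.card_erase_lt_of_mem hx) _ rfl
      obtain ⟨ua, ha', hua⟩ := step a ha
      obtain ⟨ub, hb', hub⟩ := step b hb
      obtain ⟨uc, hc', huc⟩ := step c hc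
      -- At each coordinate of `I` at most one of the three interpolants can be wrong, so the
      -- majority is right.
      refine ⟨maj.onVectors ![ua, ub, uc], onVectors_mem_Cl (.base _ rfl) ?_, fun i hi => ?_⟩
      · intro k
        change Fin 3 at k
        fin_cases k <;> assumption
      · change (ua i && ub i || ua i && uc i || ub i && uc i) = v i
        by_cases hia : i = a
        · rw [hub i (Finset.mem_erase.mpr ⟨hia ▸ hab, hi⟩),
            huc i (Finset.mem_erase.mpr ⟨hia ▸ hac, hi⟩)]
          cases ua i <;> cases v i <;> rfl
        · rw [hua i (by simp [hi, hia])]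
          by_cases hib : i = b
          · rw [huc i (Finset.mem_erase.mpr ⟨hib ▸ hbc, hi⟩)]
            cases ub i <;> cases v i <;> rfl
          · rw [hub i (by simp [hi, hib])]
            cases uc i <;> cases v i <;> rfl

/-- Positivity of `m` cannot be dropped: for `m = n = 0` the pair closure contains the empty vector,
the closure does not. -/
theorem Cl_eq_pairClosure {m n : ℕ} (hm : 0 < m) (S : Fin m → Fin n → Bool) :
    Cl D₂ (Set.range S) = pairClosure S := by
  refine (Cl_subset_pairClosure S).antisymm fun v hv => ?_
  obtain ⟨u, hu, huv⟩ := exists_mem_Cl_eqOn hm hv Finset.univ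
  rwa [← funext fun i => huv i (Finset.mem_univ i)]

/-- No operation of `D₂` is a constant of arity zero. -/
theorem arity_pos {f : Operation Bool} (hf : f ∈ D₂) : 0 < f.1 := by
  induction hf with
  | base f hf =>
    obtain rfl : f = maj := hf
    exact Nat.succ_pos 2
  | proj t k => exact k.pos
  | comp s t f g hf hg ihf ihg => exact ihg ⟨0, ihf⟩

theorem Cl_empty {n : ℕ} : Cl D₂ (∅ : Set (Fin n → Bool)) = ∅ := by
  refine Set.iUnion_eq_empty.mpr fun i => ?_
  induction i with
  | zero => rfl
  | succ k ih =>
    rw [Function.iterate_succ_apply', ih]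
    refine Set.eq_empty_of_forall_notMem ?_
    rintro w (⟨f, hf, v, hv, -⟩ | hw)
    · exact hv ⟨0, arity_pos hf⟩
    · exact hw

/-- The closure by the majority is the set of models of a conjunction of clauses with at most two
literals. -/
theorem exists_twoCNF (m n : ℕ) (S : Fin m → Fin n → Bool) : ∃ φ : Std.Sat.CNF (Fin n),
    (∀ c ∈ φ.clauses, c.length ≤ 2) ∧ Cl D₂ (Set.range S) = {v | φ.eval v = true} := by
  rcases Nat.eq_zero_or_pos m with rfl | hm
  -- A single empty clause is unsatisfiable.
  · refine ⟨⟨#[[]]⟩, by simp, ?_⟩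
    rw [Set.range_eq_empty, Cl_empty]
    simp [Std.Sat.CNF.eval]
  -- Each absent pair of values contributes the clause negating both of them.
  · let bad : Finset (Fin n × Bool × Fin n × Bool) :=
      {q | ¬ Compat S q.1 q.2.1 q.2.2.1 q.2.2.2}
    refine ⟨⟨(bad.toList.map fun q => [(q.1, !q.2.1), (q.2.2.1, !q.2.2.2)]).toArray⟩, ?_, ?_⟩
    · intro c hc
      simp only [List.mem_toArray, List.mem_map] at hc
      obtain ⟨q, -, rfl⟩ := hc
      exact le_rfl
    · rw [Cl_eq_pairClosure hm]
      ext v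
      have key : ∀ a b c d : Bool, (a == !b || c == !d) = true ↔ ¬ (a = b ∧ c = d) := by decide
      rw [Set.mem_ofPred_eq, Std.Sat.CNF.eval, Array.all_eq_true']
      simp only [List.mem_toArray, List.forall_mem_map, Finset.mem_toList, bad, Finset.mem_filter,
        Finset.mem_univ, true_and, Std.Sat.CNF.Clause.eval_cons, Std.Sat.CNF.Clause.eval_nil,
        Bool.or_false, key]
      constructor
      · rintro h ⟨i, a, j, b⟩ hq ⟨h1, h2⟩
        exact hq (h1 ▸ h2 ▸ h i j)
      · intro h i j
        by_contra hc
        exact h (i, v i, j, v j) hc ⟨rfl, rfl⟩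

/-! ## The enumeration of the pair closure by splitting branches -/

/-- A branch stands for the solutions other than `sol` that differ from `sol` only in `free`. -/
structure Branch (n : ℕ) : Type where
  free : Finset (Fin n)
  sol : Fin n → Bool

namespace Branch

variable {m n : ℕ} (S : Fin m → Fin n → Bool)

/-- The solutions that remain to be found by a branch. -/
def todo (τ : Branch n) : Set (Fin n → Bool) :=
  {v | v ∈ pairClosure S ∧ (∀ j ∉ τ.free, v j = τ.sol j) ∧ v ≠ τ.sol}

/-- The invariant of branches: the coordinates that are not free put no constraint on the free ones. -/
structure Good (τ : Branch n) : Prop where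
  sol_mem : τ.sol ∈ pairClosure S
  fixed : ∀ j ∉ τ.free, ∀ k ∈ τ.free, ∀ c, Compat S j (τ.sol j) k c
  both : ∀ k ∈ τ.free, ∀ c, Compat S k c k c

/-- Fix the value of the solution at `x`. -/
def keep (τ : Branch n) (x : Fin n) : Branch n where
  free := {k ∈ τ.free | Compat S x (τ.sol x) k (!τ.sol k)}
  sol := τ.sol

/-- Flip the value of the solution at `x`, and all values that this forces to be flipped. -/
def flip (τ : Branch n) (x : Fin n) : Branch n where
  free := {k ∈ τ.free | Compat S x (!τ.sol x) k false ∧ Compat S x (!τ.sol x) k true}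
  sol := fun j => if Compat S x (!τ.sol x) j (τ.sol j) then τ.sol j else !τ.sol j

variable {S}

theorem Good.todo_eq_empty {τ : Branch n} (h : τ.free = ∅) : τ.todo S = ∅ := by
  refine Set.eq_empty_of_forall_notMem ?_
  rintro v ⟨-, hv, hne⟩
  exact hne (funext fun j => hv j (by simp [h]))

theorem not_compat_self {x : Fin n} {a b : Bool} (h : a ≠ b) : ¬ Compat S x a x b := by
  rintro ⟨r, ha, hb⟩
  exact h (ha.symm.trans hb)

theorem notMem_keep (τ : Branch n) (x : Fin n) : x ∉ (τ.keep S x).free := by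
  simp [keep, not_compat_self]

theorem notMem_flip (τ : Branch n) (x : Fin n) : x ∉ (τ.flip S x).free := by
  cases h : τ.sol x <;> simp [flip, h, not_compat_self]

theorem flip_sol_self (τ : Branch n) (x : Fin n) : (τ.flip S x).sol x = !τ.sol x := by
  simp [flip, not_compat_self]

theorem card_keep_lt {τ : Branch n} {x : Fin n} (hx : x ∈ τ.free) :
    (τ.keep S x).free.card < τ.free.card :=
  Finset.card_lt_card <| (Finset.ssubset_iff_of_subset (Finset.filter_subset _ _)).mpr
    ⟨x, hx, τ.notMem_keep x⟩

theorem card_flip_lt {τ : Branch n} {x : Fin n} (hx : x ∈ τ.free) :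
    (τ.flip S x).free.card < τ.free.card :=
  Finset.card_lt_card <| (Finset.ssubset_iff_of_subset (Finset.filter_subset _ _)).mpr
    ⟨x, hx, τ.notMem_flip x⟩

/-- A coordinate that leaves the free set is forced by the kept value at `x`. So a vector with that
value at `x` and `c` at `k` also has the solution's value at the coordinate that left. -/
theorem Good.keep {τ : Branch n} (h : τ.Good S) (x : Fin n) : (τ.keep S x).Good S := by
  refine ⟨h.sol_mem, fun j hj k hk c => ?_, fun k hk => h.both k (Finset.mem_filter.mp hk).1⟩
  simp only [Branch.keep, Finset.mem_filter, not_and] at hj hk ⊢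
  by_cases hjf : j ∈ τ.free
  · have hc : Compat S x (τ.sol x) k c := by
      rcases Bool.eq_or_eq_not c (τ.sol k) with rfl | rfl
      · exact h.sol_mem x k
      · exact hk.2
    obtain ⟨r, hr1, hr2⟩ := hc
    refine ⟨r, ?_, hr2⟩
    by_contra hne
    exact hj hjf ⟨r, hr1, Bool.eq_not.mpr hne⟩
  · exact h.fixed j hjf k hk.1 c

/-- The vectors of `S` with the flipped value at `x` agree with the flipped solution at every
coordinate that is flipped. -/
theorem flip_sol_eq_or (τ : Branch n) (x j : Fin n) :
    (τ.flip S x).sol j = τ.sol j ∨ ∀ r, S r x = (!τ.sol x) → S r j = (τ.flip S x).sol j := by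
  by_cases hj : Compat S x (!τ.sol x) j (τ.sol j)
  · exact .inl (by simp [flip, hj])
  · refine .inr fun r hr => ?_
    simp only [flip, hj, if_false]
    exact Bool.eq_not.mpr fun h => hj ⟨r, hr, h⟩

/-- `Good.both` supplies a vector with the flipped value at `x`; if the old value at `j` is
impossible next to it, this vector must have the other one. -/
theorem Good.compat_flip {τ : Branch n} (h : τ.Good S) {x : Fin n} (hx : x ∈ τ.free) (j : Fin n) :
    Compat S x (!τ.sol x) j ((τ.flip S x).sol j) := by
  by_cases hj : Compat S x (!τ.sol x) j (τ.sol j)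
  · simp [flip, hj]
  · obtain ⟨r, hr, -⟩ := h.both x hx (!τ.sol x)
    refine ⟨r, hr, ?_⟩
    simp only [flip, hj, if_false]
    exact Bool.eq_not.mpr fun h => hj ⟨r, hr, h⟩

theorem Good.flip_sol_of_notMem {τ : Branch n} (h : τ.Good S) {x : Fin n} (hx : x ∈ τ.free)
    {j : Fin n} (hj : j ∉ τ.free) : (τ.flip S x).sol j = τ.sol j := by
  simp [flip, (h.fixed j hj x hx (!τ.sol x)).symm]

/-- This is why one round of propagation suffices. For two unchanged coordinates the old witness
works; if one coordinate is forced, any witness pairing `x` with the other coordinate has the right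
value at the forced one too. -/
theorem Good.flip_mem {τ : Branch n} (h : τ.Good S) {x : Fin n} (hx : x ∈ τ.free) :
    (τ.flip S x).sol ∈ pairClosure S := by
  intro i j
  rcases τ.flip_sol_eq_or (S := S) x i with hi | hi
  · rcases τ.flip_sol_eq_or (S := S) x j with hj | hj
    · rw [hi, hj]
      exact h.sol_mem i j
    · obtain ⟨r, hr, hri⟩ := h.compat_flip hx i
      exact ⟨r, hri, hj r hr⟩
  · obtain ⟨r, hr, hrj⟩ := h.compat_flip hx j
    exact ⟨r, hi r hr, hrj⟩

/-- Outside of the free coordinates of the flipped branch, the flipped value at `x` forces the other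
values. -/
theorem Good.forced_of_notMem_flip {τ : Branch n} (h : τ.Good S) {x : Fin n} (hx : x ∈ τ.free)
    {j : Fin n} (hj : j ∈ τ.free) (hj' : j ∉ (τ.flip S x).free) {r : Fin m}
    (hr : S r x = !τ.sol x) : S r j = (τ.flip S x).sol j := by
  rcases τ.flip_sol_eq_or (S := S) x j with he | he
  -- If `r` disagreed with `q` at `j`, both values at `j` would occur next to the flipped value at
  -- `x`, and `j` would have stayed free.
  · obtain ⟨q, hq, hqj⟩ := h.compat_flip hx j
    by_contra hne
    refine hj' (Finset.mem_filter.mpr ⟨hj, ?_⟩)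
    cases hS : S r j <;> cases hq' : S q j
    · rw [hS, ← hqj, hq'] at hne; exact absurd rfl hne
    · exact ⟨⟨r, hr, hS⟩, ⟨q, hq, hq'⟩⟩
    · exact ⟨⟨q, hq, hq'⟩, ⟨r, hr, hS⟩⟩
    · rw [hS, ← hqj, hq'] at hne; exact absurd rfl hne
  · exact he r hr

theorem Good.flip {τ : Branch n} (h : τ.Good S) {x : Fin n} (hx : x ∈ τ.free) :
    (τ.flip S x).Good S := by
  refine ⟨h.flip_mem hx, fun j hj k hk c => ?_, fun k hk => h.both k (Finset.mem_filter.mp hk).1⟩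
  have hk' := Finset.mem_filter.mp hk
  by_cases hjf : j ∈ τ.free
  · obtain ⟨r, hr, hrk⟩ : Compat S x (!τ.sol x) k c := by
      cases c
      exacts [hk'.2.1, hk'.2.2]
    exact ⟨r, h.forced_of_notMem_flip hx hjf hj hr, hrk⟩
  · rw [h.flip_sol_of_notMem hx hjf]
    exact h.fixed j hjf k hk'.1 c

/-- The solutions of a branch are split by their value at a free coordinate. -/
theorem Good.mem_todo_iff {τ : Branch n} (h : τ.Good S) {x : Fin n} (hx : x ∈ τ.free)
    (v : Fin n → Bool) : v ∈ τ.todo S ↔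
      v = (τ.flip S x).sol ∨ v ∈ (τ.flip S x).todo S ∨ v ∈ (τ.keep S x).todo S := by
  constructor
  · rintro ⟨hv, hvj, hne⟩
    rcases Bool.eq_or_eq_not (v x) (τ.sol x) with hvx | hvx
    · refine .inr (.inr ⟨hv, fun j hj => ?_, hne⟩)
      by_cases hjf : j ∈ τ.free
      · by_contra hne'
        refine hj (Finset.mem_filter.mpr ⟨hjf, ?_⟩)
        have := hv x j
        rwa [hvx, Bool.eq_not.mpr hne'] at this
      · exact hvj j hjf
    · by_cases he : v = (τ.flip S x).sol
      · exact .inl he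
      · refine .inr (.inl ⟨hv, fun j hj => ?_, he⟩)
        by_cases hjf : j ∈ τ.free
        · obtain ⟨r, hr, hrj⟩ := hv x j
          rw [← hrj]
          exact h.forced_of_notMem_flip hx hjf hj (hr.trans hvx)
        · rw [hvj j hjf, h.flip_sol_of_notMem hx hjf]
  · have hx' : τ.sol x ≠ !τ.sol x := by simp
    rintro (rfl | ⟨hv, hvj, -⟩ | ⟨hv, hvj, hne⟩)
    · refine ⟨h.flip_mem hx, fun j hj => h.flip_sol_of_notMem hx hj, fun he => hx' ?_⟩
      rw [← flip_sol_self (S := S), he]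
    · refine ⟨hv, fun j hj => ?_, fun he => hx' ?_⟩
      · rw [← h.flip_sol_of_notMem hx hj]
        exact hvj j fun hj' => hj (Finset.mem_filter.mp hj').1
      · rw [← flip_sol_self (S := S), ← hvj x (τ.notMem_flip x), he]
    · exact ⟨hv, fun j hj => hvj j fun hj' => hj (Finset.mem_filter.mp hj').1, hne⟩

theorem disjoint_flip_keep (τ : Branch n) (x : Fin n) {v : Fin n → Bool}
    (h1 : v = (τ.flip S x).sol ∨ v ∈ (τ.flip S x).todo S) : v ∉ (τ.keep S x).todo S := by
  rintro ⟨-, hv, -⟩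
  have h2 : v x = τ.sol x := hv x (τ.notMem_keep x)
  have h3 : v x = !τ.sol x := by
    rw [← flip_sol_self (S := S)]
    rcases h1 with rfl | ⟨-, hv', -⟩
    · rfl
    · exact hv' x (τ.notMem_flip x)
  simp [h2] at h3

/-! ### Stacks of branches and the enumerations they produce. -/

/-- Put a branch on a stack, unless nothing remains to be done for it. -/
def push (τ : Branch n) (st : List (Branch n)) : List (Branch n) := if τ.free = ∅ then st else τ :: st

/-- The stack after processing its top `τ` at coordinate `x`. -/
def split (S : Fin m → Fin n → Bool) (τ : Branch n) (x : Fin n) (st : List (Branch n)) :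
    List (Branch n) :=
  (τ.flip S x).push ((τ.keep S x).push st)

/-- The solutions that remain to be found by the branches of a stack. -/
def todos (S : Fin m → Fin n → Bool) (st : List (Branch n)) : Set (Fin n → Bool) :=
  {v | ∃ τ ∈ st, v ∈ τ.todo S}

/-- The invariant of stacks of branches. -/
def Ok (S : Fin m → Fin n → Bool) : List (Branch n) → Prop
  | [] => True
  | τ :: st => τ.Good S ∧ τ.free.card + st.length ≤ n ∧ Disjoint (τ.todo S) (todos S st) ∧ Ok S st

theorem mem_todos_push (τ : Branch n) (st : List (Branch n)) (v : Fin n → Bool) :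
    v ∈ todos S (τ.push st) ↔ v ∈ τ.todo S ∨ v ∈ todos S st := by
  by_cases h : τ.free = ∅
  · simp [push, h, Good.todo_eq_empty h]
  · simp [push, h, todos]

theorem length_push_le (τ : Branch n) (st : List (Branch n)) :
    (τ.push st).length ≤ st.length + 1 := by
  unfold push
  split_ifs <;> simp

theorem Ok.push {τ : Branch n} {st : List (Branch n)} (hst : Ok S st) (hτ : τ.Good S)
    (hl : τ.free.card + st.length ≤ n) (hd : Disjoint (τ.todo S) (todos S st)) :
    Ok S (τ.push st) := by
  unfold Branch.push
  split_ifs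
  · exact hst
  · exact ⟨hτ, hl, hd, hst⟩

/-- Both new branches have fewer free coordinates than the old one, which pays for the at most one
extra level under the flipped branch. -/
theorem Ok.split {τ : Branch n} {st : List (Branch n)} (h : Ok S (τ :: st)) {x : Fin n}
    (hx : x ∈ τ.free) : Ok S (τ.split S x st) := by
  obtain ⟨hτ, hl, hd, hst⟩ := h
  rw [Set.disjoint_left] at hd
  have hk : Ok S ((τ.keep S x).push st) := by
    refine hst.push (hτ.keep x) ?_ (Set.disjoint_left.mpr fun v hv => hd ?_)
    · have := card_keep_lt (S := S) hx
      omega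
    · exact (hτ.mem_todo_iff hx v).mpr (.inr (.inr hv))
  refine hk.push (hτ.flip hx) ?_ (Set.disjoint_left.mpr fun v hv hv' => ?_)
  · have := card_flip_lt (S := S) hx
    have := (τ.keep S x).length_push_le st
    omega
  · rcases (mem_todos_push _ _ _).mp hv' with h' | h'
    · exact τ.disjoint_flip_keep x (.inr hv) h'
    · exact hd ((hτ.mem_todo_iff hx v).mpr (.inr (.inl hv))) h'

/-- The possible enumerations of the solutions of a stack of branches. -/
inductive Lists (S : Fin m → Fin n → Bool) : List (Branch n) → List (Fin n → Bool) → Prop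
  | nil : Lists S [] []
  | step {τ : Branch n} {st : List (Branch n)} {x : Fin n} {L : List (Fin n → Bool)} (hx : x ∈ τ.free)
      (h : Lists S (τ.split S x st) L) : Lists S (τ :: st) ((τ.flip S x).sol :: L)

theorem Lists.spec {st : List (Branch n)} {L : List (Fin n → Bool)} (h : Lists S st L)
    (hst : Ok S st) : L.Nodup ∧ ∀ v, v ∈ L ↔ v ∈ todos S st := by
  induction h with
  | nil => simp [todos]
  | @step τ st x L hx h ih =>
    obtain ⟨hnd, hmem⟩ := ih (hst.split hx)
    obtain ⟨hτ, -, hd, -⟩ := hst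
    rw [Set.disjoint_left] at hd
    refine ⟨List.nodup_cons.mpr ⟨fun hL => ?_, hnd⟩, fun v => ?_⟩
    · rw [hmem, Branch.split, mem_todos_push, mem_todos_push] at hL
      rcases hL with hL | hL | hL
      · exact hL.2.2 rfl
      · exact τ.disjoint_flip_keep x (.inl rfl) hL
      · exact hd ((hτ.mem_todo_iff hx _).mpr (.inl rfl)) hL
    · rw [List.mem_cons, hmem, Branch.split, mem_todos_push, mem_todos_push]
      have : v ∈ todos S (τ :: st) ↔ v ∈ τ.todo S ∨ v ∈ todos S st := by simp [todos]
      rw [this, hτ.mem_todo_iff hx]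
      tauto

/-- A bound on the number of branches that are still to be processed. -/
def weight (st : List (Branch n)) : ℕ := (st.map fun τ => 3 ^ τ.free.card).sum

/-- Each part loses a free coordinate and `2 * 3 ^ c < 3 ^ (c + 1)`. The weight may be exponential:
it serves termination and does not enter the delay. -/
theorem weight_split_lt {τ : Branch n} (st : List (Branch n)) {x : Fin n} (hx : x ∈ τ.free) :
    weight (τ.split S x st) < weight (τ :: st) := by
  have hp : ∀ (σ : Branch n) (st : List (Branch n)), weight (σ.push st) ≤ 3 ^ σ.free.card + weight st := by
    intro σ st
    unfold push
    split_ifs <;> simp [weight]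
  have h1 := hp (τ.flip S x) ((τ.keep S x).push st)
  have h2 := hp (τ.keep S x) st
  have h3 : weight (τ :: st) = 3 ^ τ.free.card + weight st := by simp [weight]
  obtain ⟨c, hc⟩ : ∃ c, τ.free.card = c + 1 :=
    ⟨_, (Nat.succ_pred_eq_of_pos (Finset.card_pos.mpr ⟨x, hx⟩)).symm⟩
  have h4 : 3 ^ (τ.flip S x).free.card ≤ 3 ^ c :=
    Nat.pow_le_pow_right (by omega) (by have := card_flip_lt (S := S) hx; omega)
  have h5 : 3 ^ (τ.keep S x).free.card ≤ 3 ^ c :=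
    Nat.pow_le_pow_right (by omega) (by have := card_keep_lt (S := S) hx; omega)
  have h6 : 0 < 3 ^ c := by positivity
  rw [hc, pow_succ] at h3
  unfold split
  omega

/-! ### The initial branch. -/

/-- The first branch: all solutions other than a given vector of `S`. -/
def start (S : Fin m → Fin n → Bool) (r : Fin m) : Branch n where
  free := {k | Compat S k false k false ∧ Compat S k true k true}
  sol := S r

/-- A coordinate is initially not free exactly when one of the two values never occurs there. -/
theorem start_forced (r : Fin m) {j : Fin n} (hj : j ∉ (start S r).free) (q : Fin m) :
    S q j = S r j := by
  by_contra hne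
  refine hj (Finset.mem_filter.mpr ⟨Finset.mem_univ j, ?_⟩)
  cases h1 : S q j <;> cases h2 : S r j
  · rw [h1, h2] at hne; exact absurd rfl hne
  · exact ⟨⟨q, h1, h1⟩, ⟨r, h2, h2⟩⟩
  · exact ⟨⟨r, h2, h2⟩, ⟨q, h1, h1⟩⟩
  · rw [h1, h2] at hne; exact absurd rfl hne

theorem start_good (r : Fin m) : (start S r).Good S := by
  have both : ∀ k ∈ (start S r).free, ∀ c, Compat S k c k c := by
    intro k hk c
    have := (Finset.mem_filter.mp hk).2
    cases c
    exacts [this.1, this.2]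
  refine ⟨fun i j => ⟨r, rfl, rfl⟩, fun j hj k hk c => ?_, both⟩
  obtain ⟨q, hq, -⟩ := both k hk c
  exact ⟨q, start_forced r hj q, hq⟩

theorem start_todo (r : Fin m) : (start S r).todo S = pairClosure S \ {S r} := by
  ext v
  refine ⟨fun h => ⟨h.1, h.2.2⟩, fun h => ⟨h.1, fun j hj => ?_, h.2⟩⟩
  obtain ⟨q, hq, -⟩ := h.1 j j
  rw [← hq]
  exact start_forced r hj q

theorem start_ok (r : Fin m) : Ok S ((start S r).push []) := by
  refine Ok.push trivial (start_good r) ?_ (by simp [todos])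
  simpa using Finset.card_le_univ (start S r).free

/-- An enumeration of the first branch after its own solution is an enumeration of the pair
closure. -/
theorem Lists.start_spec {r : Fin m} {L : List (Fin n → Bool)}
    (h : Lists S ((start S r).push []) L) :
    (S r :: L).Nodup ∧ ∀ v, v ∈ S r :: L ↔ v ∈ pairClosure S := by
  obtain ⟨hnd, hmem⟩ := h.spec (start_ok r)
  have hmem' : ∀ v, v ∈ L ↔ v ∈ pairClosure S \ {S r} := fun v => by
    rw [hmem, mem_todos_push, start_todo]
    simp [todos]
  refine ⟨List.nodup_cons.mpr ⟨fun hL => ((hmem' _).mp hL).2 rfl, hnd⟩, fun v => ?_⟩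
  rw [List.mem_cons, hmem']
  by_cases hv : v = S r
  · have h : S r ∈ pairClosure S := (start_good r).sol_mem
    simpa [hv] using h
  · simp [hv]

end Branch

/-! ## The program -/

namespace RAM

instance : Add Expr := ⟨.add⟩
instance : Sub Expr := ⟨.sub⟩
instance : Mul Expr := ⟨.mul⟩
instance (k : ℕ) : OfNat Expr k := ⟨.const k⟩

namespace Expr

variable (w : List ℕ) (σ : Store)

@[simp] theorem val_add (a b : Expr) : (a + b).val w σ = a.val w σ + b.val w σ := rfl
@[simp] theorem val_sub (a b : Expr) : (a - b).val w σ = a.val w σ - b.val w σ := rfl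
@[simp] theorem val_mul (a b : Expr) : (a * b).val w σ = a.val w σ * b.val w σ := rfl
@[simp] theorem val_zero : (0 : Expr).val w σ = 0 := rfl
@[simp] theorem val_one : (1 : Expr).val w σ = 1 := rfl
@[simp] theorem val_two : (2 : Expr).val w σ = 2 := rfl
@[simp] theorem val_var (x : ℕ) : (Expr.var x).val w σ = σ.var x := rfl
@[simp] theorem val_get (k : ℕ) (a : Expr) : (Expr.get k a).val w σ = σ.mem k (a.val w σ) := rfl
@[simp] theorem val_inp (a : Expr) : (Expr.inp a).val w σ = w.getD (a.val w σ) 0 := rfl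

end Expr

/-- The cell of the table for the values `a` at `i` and `b` at `j`. -/
def cell (i a j b : Expr) : Expr := (2 * i + a) * (2 * .var 1) + (2 * j + b)

@[simp] theorem val_cell (w : List ℕ) (σ : Store) (i a j b : Expr) : (cell i a j b).val w σ =
    (2 * i.val w σ + a.val w σ) * (2 * σ.var 1) + (2 * j.val w σ + b.val w σ) :=
  rfl

/-- Keep `x` or replace it by the successor of the loop index, according to the bit `f`. -/
def track (x : ℕ) (f : Expr) : Cmd := .assign x (.var x * (1 - f) + (.var 4 + 1) * f)

/-- Computes the table of all compatible pairs of values. -/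
def tableCmd : Cmd :=
  .seq (.assign 0 (.inp 0)) <| .seq (.assign 1 (.inp 1)) <|
  .loop 2 0 <| .loop 3 1 <| .loop 4 1 <|
    .store 0 (cell (.var 3) (.inp (2 + (.var 2 * .var 1 + .var 3)))
      (.var 4) (.inp (2 + (.var 2 * .var 1 + .var 4)))) 1

/-- Computes the first solution and the first branch. -/
def startCmd : Cmd :=
  .seq (.assign 6 0) <|
  .seq (.loop 4 1 <|
    .seq (.store 1 (.var 4) (.inp (2 + .var 4))) <|
    .seq (.put (.var 4) (.inp (2 + .var 4))) <|
    .seq (.assign 11 (.get 0 (cell (.var 4) 0 (.var 4) 0) *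
      .get 0 (cell (.var 4) 1 (.var 4) 1))) <|
    .seq (.store 2 (.var 4) (.var 11)) <|
    track 6 (.var 11)) <|
  .seq (.store 3 0 (.var 6)) <|
  .assign 5 (1 - (1 - .var 6))

/-- Finds a free coordinate of the branch that keeps the value at the coordinate `R 9`. -/
def keepCmd : Cmd :=
  .seq (.assign 6 0) <|
  .loop 4 1 <|
    .seq (.assign 11 (.get 2 (.var 5 * .var 1 + .var 4) *
      .get 0 (cell (.var 9) (.var 10) (.var 4) (1 - .get 1 (.var 5 * .var 1 + .var 4))))) <|
    track 6 (.var 11)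

/-- Writes the branch that keeps the value at the coordinate `R 9` to level `R 5`, the one that
flips it to level `R 8`, and the solution of the latter to the output registers. -/
def flipCmd : Cmd :=
  .seq (.assign 7 0) <|
  .loop 4 1 <|
    .seq (.assign 11 (.get 2 (.var 5 * .var 1 + .var 4))) <|
    .seq (.assign 12 (.get 1 (.var 5 * .var 1 + .var 4))) <|
    .seq (.store 2 (.var 5 * .var 1 + .var 4)
      (.var 11 * .get 0 (cell (.var 9) (.var 10) (.var 4) (1 - .var 12)))) <|
    .seq (.assign 11 (.var 11 * (.get 0 (cell (.var 9) (1 - .var 10) (.var 4) 0) *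
      .get 0 (cell (.var 9) (1 - .var 10) (.var 4) 1)))) <|
    .seq (.assign 13 (.get 0 (cell (.var 9) (1 - .var 10) (.var 4) (.var 12)))) <|
    .seq (.assign 12 (.var 12 * .var 13 + (1 - .var 12) * (1 - .var 13))) <|
    .seq (.store 2 (.var 8 * .var 1 + .var 4) (.var 11)) <|
    .seq (.store 1 (.var 8 * .var 1 + .var 4) (.var 12)) <|
    .seq (.put (.var 4) (.var 12)) <|
    track 7 (.var 11)

/-- Processes the topmost branch of the stack. -/
def stepCmd : Cmd :=
  .seq (.assign 5 (.var 5 - 1)) <|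
  .seq (.assign 9 (.get 3 (.var 5) - 1)) <|
  .seq (.assign 10 (.get 1 (.var 5 * .var 1 + .var 9))) <|
  .seq keepCmd <|
  .seq (.assign 8 (.var 5 + (1 - (1 - .var 6)))) <|
  .seq flipCmd <|
  .seq (.store 3 (.var 5) (.var 6)) <|
  .seq (.store 3 (.var 8) (.var 7)) <|
  .assign 5 (.var 8 + (1 - (1 - .var 7)))

/-- Any common bound on the exponents would do; 200 becomes the degree of the polynomial bounding
the registers. -/
theorem tableCmd_wf : tableCmd.wf 200 = true := by decide
theorem startCmd_wf : startCmd.wf 200 = true := by decide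
theorem stepCmd_wf : stepCmd.wf 200 = true := by decide

end RAM

/-! ### Words of the input -/

theorem divNat_modNat {m n : ℕ} (i : Fin m) (j : Fin n) (h : (i : ℕ) * n + j < m * n) :
    Fin.divNat (⟨i * n + j, h⟩ : Fin (m * n)) = i ∧ Fin.modNat (⟨i * n + j, h⟩ : Fin (m * n)) = j := by
  have e : (⟨i * n + j, h⟩ : Fin (m * n)) = Fin.mkDivMod i j := by
    ext; simp [Fin.mkDivMod, Nat.mul_comm]
  rw [e]
  exact ⟨Fin.divNat_mkDivMod i j, Fin.modNat_mkDivMod i j⟩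

theorem encodeInstance_eq {m n : ℕ} (S : Fin m → Fin n → Bool) :
    encodeInstance S = m :: n :: List.ofFn fun k : Fin (m * n) =>
      (S k.divNat k.modNat).toNat := by
  unfold encodeInstance encodeVector
  rw [List.ofFn_mul]
  simp only [divNat_modNat]

theorem encodeInstance_getD {m n : ℕ} (S : Fin m → Fin n → Bool) (i : Fin m) (j : Fin n) :
    (encodeInstance S).getD (2 + (i * n + j)) 0 = (S i j).toNat := by
  have hlt : (i : ℕ) * n + j < m * n := by
    have h1 := Nat.mul_le_mul_right n i.isLt
    have h2 := j.isLt
    rw [Nat.succ_mul] at h1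
    omega
  rw [encodeInstance_eq, Nat.add_comm 2]
  simp [List.getD_eq_getElem?_getD, hlt, divNat_modNat]

theorem encodeInstance_getD_le {m n : ℕ} (S : Fin m → Fin n → Bool) (a : ℕ) :
    (encodeInstance S).getD a 0 ≤ m + n + 1 := by
  have h : ∀ x ∈ encodeInstance S, x ≤ m + n + 1 := by
    rw [encodeInstance_eq]
    intro x hx
    simp only [List.mem_cons, List.mem_ofFn'] at hx
    rcases hx with rfl | rfl | ⟨k, rfl⟩
    · omega
    · omega
    · exact (Bool.toNat_le _).trans (by omega)
  rw [List.getD_eq_getElem?_getD]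
  rcases lt_or_ge a (encodeInstance S).length with ha | ha
  · simpa [ha] using h _ (List.getElem_mem ha)
  · simp [ha]

/-! ### Correctness of the program -/

/-- Separates the cells of everything stored row by row: the table of pairs and the levels of the
stack. -/
theorem row_col_inj {p q p' q' w : ℕ} (hq : q < w) (hq' : q' < w) :
    p * w + q = p' * w + q' ↔ p = p' ∧ q = q' := by
  refine ⟨fun h => ?_, fun ⟨h1, h2⟩ => by rw [h1, h2]⟩
  have hp : p = p' := by
    have h1 : (p * w + q) / w = p := by
      rw [mul_comm, Nat.mul_add_div (by omega), Nat.div_eq_of_lt hq, add_zero]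
    have h2 : (p' * w + q') / w = p' := by
      rw [mul_comm, Nat.mul_add_div (by omega), Nat.div_eq_of_lt hq', add_zero]
    rw [← h1, h, h2]
  subst hp
  exact ⟨rfl, by omega⟩

theorem cell_inj {n : ℕ} {i j i' j' : Fin n} {a b a' b' : Bool} :
    (2 * (i : ℕ) + a.toNat) * (2 * n) + (2 * j + b.toNat) =
      (2 * i' + a'.toNat) * (2 * n) + (2 * j' + b'.toNat) ↔
      i = i' ∧ a = a' ∧ j = j' ∧ b = b' := by
  have hj := j.isLt
  have hj' := j'.isLt
  rw [row_col_inj (by have := b.toNat_le; omega) (by have := b'.toNat_le; omega), Fin.ext_iff,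
    Fin.ext_iff]
  cases a <;> cases b <;> cases a' <;> cases b' <;> simp <;> omega

/-- `x` is zero if no element below `k` has the property `p`, and the successor of such an element
otherwise. -/
def Tracks {n : ℕ} (p : Fin n → Prop) (k x : ℕ) : Prop :=
  (x = 0 ∧ ∀ j : Fin n, (j : ℕ) < k → ¬ p j) ∨ ∃ j : Fin n, x = j + 1 ∧ p j

namespace Tracks

variable {n : ℕ} {p : Fin n → Prop}

theorem zero : Tracks p 0 0 := .inl ⟨rfl, fun _ h => absurd h (Nat.not_lt_zero _)⟩

theorem le {k x : ℕ} (h : Tracks p k x) : x ≤ n := by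
  rcases h with ⟨rfl, -⟩ | ⟨j, rfl, -⟩
  · exact Nat.zero_le n
  · exact j.isLt

/-- The language has no conditional, so the choice is made by multiplying with an indicator, as in
`RAM.track`. -/
theorem succ [DecidablePred p] {x : ℕ} {j : Fin n} (h : Tracks p j x) :
    Tracks p (j + 1) (x * (1 - if p j then 1 else 0) + (j + 1) * if p j then 1 else 0) := by
  by_cases hj : p j
  · exact .inr ⟨j, by simp [hj], hj⟩
  · rcases h with ⟨rfl, h⟩ | ⟨i, rfl, hi⟩
    · refine .inl ⟨by simp [hj], fun i hi => ?_⟩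
      rcases Nat.lt_succ_iff_lt_or_eq.mp hi with hi | hi
      · exact h i hi
      · rwa [Fin.ext hi]
    · exact .inr ⟨i, by simp [hj], hi⟩

end Tracks

theorem ite_mul_ite_one (P Q : Prop) [Decidable P] [Decidable Q] :
    ((if P then 1 else 0) * if Q then 1 else 0 : ℕ) = if P ∧ Q then 1 else 0 := by
  by_cases hP : P <;> by_cases hQ : Q <;> simp [hP, hQ]

theorem one_sub_toNat (b : Bool) : 1 - b.toNat = (!b).toNat := by cases b <;> rfl

theorem toNat_select (P : Prop) [Decidable P] (b : Bool) :
    b.toNat * (if P then 1 else 0) + (1 - b.toNat) * (1 - if P then 1 else 0) =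
      (if P then b else !b).toNat := by
  by_cases hP : P <;> cases b <;> simp [hP]

/-! ### Memory representation of branches, and the table of compatible pairs. -/

namespace RAM

open Branch

variable {m n : ℕ} (S : Fin m → Fin n → Bool)

/-- The array `t` is the table of all compatible pairs of values. -/
def IsTable (t : ℕ → ℕ) : Prop :=
  ∀ (i j : Fin n) (a b : Bool), t ((2 * i + a.toNat) * (2 * n) + (2 * j + b.toNat)) =
    if Compat S i a j b then 1 else 0

/-- Level `h` of the stack holds the branch `τ`. -/
def IsFrame (mem : ℕ → ℕ → ℕ) (h : ℕ) (τ : Branch n) : Prop :=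
  (∀ j : Fin n, mem 1 (h * n + j) = (τ.sol j).toNat ∧
    mem 2 (h * n + j) = if j ∈ τ.free then 1 else 0) ∧
  Tracks (· ∈ τ.free) n (mem 3 h)

/-- The levels of the stack hold the given branches, the topmost first. -/
def IsStack (mem : ℕ → ℕ → ℕ) : List (Branch n) → Prop
  | [] => True
  | τ :: st => IsFrame mem st.length τ ∧ τ.free ≠ ∅ ∧ IsStack mem st

/-- The store is ready to process the stack. -/
structure Ready (st : List (Branch n)) (σ : Store) : Prop where
  size : σ.var 1 = n
  height : σ.var 5 = st.length
  table : IsTable S (σ.mem 0)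
  stack : IsStack σ.mem st

theorem IsStack.congr {mem mem' : ℕ → ℕ → ℕ} {st : List (Branch n)} (h : IsStack mem st)
    (h' : ∀ l < st.length, (∀ j : Fin n, mem' 1 (l * n + j) = mem 1 (l * n + j) ∧
      mem' 2 (l * n + j) = mem 2 (l * n + j)) ∧ mem' 3 l = mem 3 l) : IsStack mem' st := by
  induction st with
  | nil => trivial
  | cons τ st ih =>
    obtain ⟨⟨h1, h2⟩, h3, h4⟩ := h
    have hl := h' st.length (by simp)
    refine ⟨⟨fun j => ?_, ?_⟩, h3, ih h4 fun l hl => h' l (by simp; omega)⟩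
    · rw [(hl.1 j).1, (hl.1 j).2]
      exact h1 j
    · rw [hl.2]
      exact h2

theorem IsStack.push {mem : ℕ → ℕ → ℕ} {st : List (Branch n)} (h : IsStack mem st)
    {τ : Branch n} (hτ : IsFrame mem st.length τ) : IsStack mem (τ.push st) := by
  unfold Branch.push
  split_ifs with h0
  · exact h
  · exact ⟨hτ, h0, h⟩

/-- `1 - (1 - x)` is the indicator of `x ≠ 0`, so the machine updates the height of the stack
without branching. -/
theorem Tracks.length_push {τ : Branch n} (st : List (Branch n)) {x : ℕ}
    (h : Tracks (· ∈ τ.free) n x) : (τ.push st).length = st.length + (1 - (1 - x)) := by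
  unfold Branch.push
  rcases h with ⟨rfl, h⟩ | ⟨j, rfl, h⟩
  · rw [if_pos (Finset.eq_empty_of_forall_notMem fun j => h j j.isLt)]
    rfl
  · rw [if_neg (Finset.ne_empty_of_mem h)]
    simp

theorem tableCmd_wp {β N : ℕ} (hβ : m + n + 1 ≤ β)
    (hN : m + n ≤ N) (σ : Store) (hσ : ∀ k i, σ.mem k i = 0) (Q : Store → Prop)
    (hQ : ∀ τ : Store, τ.var 0 = m → τ.var 1 = n → IsTable S (τ.mem 0) → Q τ) :
    tableCmd.wp (encodeInstance S) β N Q σ := by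
  -- the pairs that are found before round `l` of the innermost loop
  let I (k x l : ℕ) (τ : Store) : Prop := τ.var 0 = m ∧ τ.var 1 = n ∧
    ∀ (i j : Fin n) (a b : Bool), τ.mem 0 ((2 * i + a.toNat) * (2 * n) + (2 * j + b.toNat)) ≤ 1 ∧
      (τ.mem 0 ((2 * i + a.toNat) * (2 * n) + (2 * j + b.toNat)) = 1 ↔ ∃ r : Fin m,
        ((r : ℕ) < k ∨ (r : ℕ) = k ∧ ((i : ℕ) < x ∨ (i : ℕ) = x ∧ (j : ℕ) < l)) ∧
          S r i = a ∧ S r j = b)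
  have h0 : (encodeInstance S).getD 0 0 = m := rfl
  have h1 : (encodeInstance S).getD 1 0 = n := rfl
  simp only [tableCmd, Cmd.wp, Expr.val_inp, Expr.val_zero, Expr.val_one, h0, h1]
  refine ⟨by omega, by omega, fun k => I k 0 0, ?_, ?_, ?_, ?_⟩
  · simp [Store.setVar]; omega
  · simp [I, Store.setVar, hσ]
  · intro k hk τ hI hτ2 hτ0
    have hkm : k < m := by simpa [Store.setVar] using hk
    refine ⟨fun x τ => I k x 0 τ ∧ τ.var 2 = k, by rw [hI.2.1]; omega, ?_, ?_, ?_⟩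
    · simpa [I, Store.setVar, hτ2] using hI
    · rw [hI.2.1]
      rintro x hx τ ⟨hI, hτ2⟩ hτ3 hτ1
      refine ⟨fun l τ => I k x l τ ∧ τ.var 2 = k ∧ τ.var 3 = x, by rw [hI.2.1]; omega, ?_, ?_, ?_⟩
      · simpa [I, Store.setVar, hτ2, hτ3] using hI
      · rw [hI.2.1]
        rintro l hl τ ⟨⟨e0, e1, hI⟩, e2, e3⟩ e4 -
        have hx' := encodeInstance_getD S ⟨k, hkm⟩ ⟨x, hx⟩
        have hl' := encodeInstance_getD S ⟨k, hkm⟩ ⟨l, hl⟩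
        have key := fun i j a b => @cell_inj n i j ⟨x, hx⟩ ⟨l, hl⟩ a b (S ⟨k, hkm⟩ ⟨x, hx⟩)
          (S ⟨k, hkm⟩ ⟨l, hl⟩)
        simp only at hx' hl' key
        simp only [val_cell, Expr.val_inp, Expr.val_add, Expr.val_two,
          Expr.val_mul, Expr.val_var, e1, e2, e3, e4, hx', hl']
        refine ⟨by omega, e4, e1, ⟨e0, e1, fun i j a b => ?_⟩, e2, e3⟩
        simp only [Store.setVar, Store.setMem, true_and, key]
        split_ifs with hc
        · obtain ⟨rfl, rfl, rfl, rfl⟩ := hc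
          exact ⟨le_rfl, fun _ => ⟨⟨k, hkm⟩, .inr ⟨rfl, .inr ⟨rfl, Nat.lt_succ_self l⟩⟩, rfl, rfl⟩,
            fun _ => rfl⟩
        · refine ⟨(hI i j a b).1, (hI i j a b).2.trans (exists_congr fun r => ?_)⟩
          refine and_congr_left fun hab => ?_
          -- The only triple added by advancing the position is the current one, and it would have
          -- hit the cell just written.
          have : ¬ ((r : ℕ) = k ∧ (i : ℕ) = x ∧ (j : ℕ) = l) := by
            rintro ⟨h1, h2, h3⟩
            obtain rfl : r = ⟨k, hkm⟩ := Fin.ext h1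
            obtain rfl : i = ⟨x, hx⟩ := Fin.ext h2
            obtain rfl : j = ⟨l, hl⟩ := Fin.ext h3
            exact hc ⟨rfl, hab.1.symm, rfl, hab.2.symm⟩
          omega
      · rintro τ ⟨⟨e0, e1, h⟩, e2, e3⟩ - -
        -- Every `j` is below `n`, so the lexicographic position `(k, x, n)` amounts to `(k, x + 1,
        -- 0)`.
        refine ⟨e3, e1, ⟨e0, e1, fun i j a b => ⟨(h i j a b).1, (h i j a b).2.trans ?_⟩⟩, e2⟩
        refine exists_congr fun r => and_congr_left fun _ => ?_
        have := j.isLt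
        rw [hI.2.1]
        omega
    · rintro τ ⟨⟨e0, e1, h⟩, e2⟩ - -
      refine ⟨e2, e0, e0, e1, fun i j a b => ⟨(h i j a b).1, (h i j a b).2.trans ?_⟩⟩
      refine exists_congr fun r => and_congr_left fun _ => ?_
      have := i.isLt
      rw [hI.2.1]
      omega
  · rintro τ ⟨e0, e1, h⟩ - -
    refine hQ τ e0 e1 fun i j a b => ?_
    have hm : ((σ.setVar 0 m).setVar 1 n).var 0 = m := by simp [Store.setVar]
    obtain ⟨h1, h2⟩ := h i j a b
    split_ifs with hc
    · obtain ⟨r, hr⟩ := hc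
      exact h2.mpr ⟨r, .inl (by rw [hm]; exact r.isLt), hr⟩
    · have : ¬ τ.mem 0 _ = 1 := fun h => hc (let ⟨r, hr⟩ := h2.mp h; ⟨r, hr.2⟩)
      omega

end RAM

/-! ### Verification of the start and of one step of the main loop. -/

namespace RAM

open Branch

variable {m n : ℕ} (S : Fin m → Fin n → Bool)

theorem startCmd_wp {β N : ℕ} (hw : ∀ a, (encodeInstance S).getD a 0 ≤ β) (hβ : m + n + 1 ≤ β)
    (hN : m + n ≤ N) (σ : Store) (h0 : σ.var 0 = m) (h1 : σ.var 1 = n) (hT : IsTable S (σ.mem 0))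
    (Q : Store → Prop)
    (hQ : ∀ τ : Store, τ.var 0 = m → τ.var 1 = n → (∀ hm : 0 < m,
      Ready S ((start S ⟨0, hm⟩).push []) τ ∧ ∀ j : Fin n, τ.out j = (S ⟨0, hm⟩ j).toNat) → Q τ) :
    startCmd.wp (encodeInstance S) β N Q σ := by
  let p (j : Fin n) : Prop := Compat S j false j false ∧ Compat S j true j true
  let I (k : ℕ) (τ : Store) : Prop := τ.var 0 = m ∧ τ.var 1 = n ∧ IsTable S (τ.mem 0) ∧
    Tracks p k (τ.var 6) ∧ ∀ j : Fin n, (j : ℕ) < k →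
      τ.mem 1 j = (encodeInstance S).getD (2 + j) 0 ∧ τ.mem 2 j = (if p j then 1 else 0) ∧
      τ.out j = (encodeInstance S).getD (2 + j) 0
  simp only [startCmd, track, Cmd.wp, Expr.val_zero]
  refine ⟨Nat.zero_le _, I, ?_, ?_, ?_, ?_⟩
  · simp [Store.setVar, h1]; omega
  · exact ⟨h0, h1, hT, Tracks.zero, fun j hj => absurd hj (Nat.not_lt_zero _)⟩
  · have e1 : (σ.setVar 6 0).var 1 = n := by simp [Store.setVar, h1]
    rw [e1]
    rintro k hk τ ⟨e0, e1, hT, hx, hj⟩ e4 -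
    -- Naming the indicator keeps it an opaque number in the arithmetic side conditions.
    obtain ⟨f, hf⟩ : ∃ f, f = if p ⟨k, hk⟩ then 1 else 0 := ⟨_, rfl⟩
    have hf' : τ.mem 0 ((2 * k + 0) * (2 * n) + (2 * k + 0)) *
        τ.mem 0 ((2 * k + 1) * (2 * n) + (2 * k + 1)) = f := by
      have h1 := hT ⟨k, hk⟩ ⟨k, hk⟩ false false
      have h2 := hT ⟨k, hk⟩ ⟨k, hk⟩ true true
      simp only [Bool.toNat_false, Bool.toNat_true] at h1 h2
      rw [h1, h2, ite_mul_ite_one, hf]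
    have hf1 : f ≤ 1 := by rw [hf]; split_ifs <;> simp
    have hx' : Tracks p (k + 1) (τ.var 6 * (1 - f) + (k + 1) * f) := by
      rw [hf]; exact hx.succ (j := ⟨k, hk⟩)
    have hx1 := hx'.le
    have hwk := hw (2 + k)
    simp +decide only [val_cell, Expr.val_add, Expr.val_sub, Expr.val_mul, Expr.val_var,
      Expr.val_get, Expr.val_inp, Expr.val_zero, Expr.val_one, Expr.val_two, Store.setVar,
      Store.setMem, Store.setOut, Function.update_apply, if_true, if_false, false_and, true_and,
      e1, e4, hf', I]
    refine ⟨hwk, hwk, by omega, by omega, by omega, e0, hT, hx', fun j hjk => ?_⟩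
    rcases Nat.lt_succ_iff_lt_or_eq.mp hjk with hjk | hjk
    · simpa only [if_neg hjk.ne] using hj j hjk
    · obtain rfl : j = ⟨k, hk⟩ := Fin.ext hjk
      simp only [if_true, true_and, and_true]
      exact hf
  · have e1 : (σ.setVar 6 0).var 1 = n := by simp [Store.setVar, h1]
    rw [e1]
    rintro τ ⟨e0, e1, hT, hx, hj⟩ - -
    have hxn := hx.le
    refine ⟨by simpa using by omega, by simp; omega, ?_⟩
    refine hQ _ (by simpa [Store.setVar, Store.setMem] using e0)
      (by simpa [Store.setVar, Store.setMem] using e1) fun hm => ⟨⟨?_, ?_, ?_, ?_⟩, fun j => ?_⟩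
    · simpa [Store.setVar, Store.setMem] using e1
    · have := Tracks.length_push (τ := start S ⟨0, hm⟩) [] (x := τ.var 6) (by
        simpa [start, p] using hx)
      rw [this]
      simp [Store.setVar, Store.setMem]
    · simpa [Store.setVar, Store.setMem] using hT
    · refine IsStack.push (st := []) trivial ⟨fun j => ?_, ?_⟩
      · obtain ⟨h1, h2, -⟩ := hj j j.isLt
        have h3 := encodeInstance_getD S ⟨0, hm⟩ j
        simp only [zero_mul, zero_add] at h3
        rw [h3] at h1
        simpa [Store.setVar, Store.setMem, start, p] using And.intro h1 h2
      · simpa [Store.setVar, Store.setMem, start, p] using hx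
    · have h3 := encodeInstance_getD S ⟨0, hm⟩ j
      simp only [zero_mul, zero_add] at h3
      rw [← h3]
      exact (hj j j.isLt).2.2

theorem keepCmd_wp {β N : ℕ} (w : List ℕ) (hβ : n + 1 ≤ β) (hN : n ≤ N) (σ : Store)
    (h1 : σ.var 1 = n) (hT : IsTable S (σ.mem 0)) {τ : Branch n} {h : ℕ} {x : Fin n}
    (h5 : σ.var 5 = h) (h9 : σ.var 9 = x) (h10 : σ.var 10 = (τ.sol x).toNat)
    (hτ : ∀ j : Fin n, σ.mem 1 (h * n + j) = (τ.sol j).toNat ∧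
      σ.mem 2 (h * n + j) = if j ∈ τ.free then 1 else 0)
    (Q : Store → Prop)
    (hQ : ∀ ρ : Store, ρ.mem = σ.mem → (∀ y, y ≠ 4 → y ≠ 6 → y ≠ 11 → ρ.var y = σ.var y) →
      Tracks (· ∈ (τ.keep S x).free) n (ρ.var 6) → Q ρ) :
    keepCmd.wp w β N Q σ := by
  let I (k : ℕ) (ρ : Store) : Prop := ρ.mem = σ.mem ∧
    (∀ y, y ≠ 4 → y ≠ 6 → y ≠ 11 → ρ.var y = σ.var y) ∧
    Tracks (· ∈ (τ.keep S x).free) k (ρ.var 6)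
  simp only [keepCmd, track, Cmd.wp, Expr.val_zero]
  have e1 : (σ.setVar 6 0).var 1 = n := by simp [Store.setVar, h1]
  rw [e1]
  refine ⟨Nat.zero_le _, I, hN, ?_, ?_, ?_⟩
  · refine ⟨rfl, fun y h4 h6 h11 => ?_, Tracks.zero⟩
    simp [Store.setVar, h4, h6]
  · rintro k hk ρ ⟨hm, hv, hx⟩ e4 e1
    have e5 := (hv 5 (by decide) (by decide) (by decide)).trans h5
    have e9 := (hv 9 (by decide) (by decide) (by decide)).trans h9
    have e10 := (hv 10 (by decide) (by decide) (by decide)).trans h10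
    obtain ⟨f, hf⟩ : ∃ f, f = if (⟨k, hk⟩ : Fin n) ∈ (τ.keep S x).free then 1 else 0 := ⟨_, rfl⟩
    obtain ⟨hs, hfree⟩ := hτ ⟨k, hk⟩
    have ht := hT x ⟨k, hk⟩ (τ.sol x) (!τ.sol ⟨k, hk⟩)
    simp only at hs hfree ht
    have hf' : σ.mem 2 (h * n + k) * σ.mem 0 ((2 * x + (τ.sol x).toNat) * (2 * n) +
        (2 * k + (1 - σ.mem 1 (h * n + k)))) = f := by
      rw [hfree, hs, one_sub_toNat, ht, ite_mul_ite_one, hf]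
      simp only [keep, Finset.mem_filter]
    have hf1 : f ≤ 1 := by rw [hf]; split_ifs <;> simp
    have hx' : Tracks (· ∈ (τ.keep S x).free) (k + 1) (ρ.var 6 * (1 - f) + (k + 1) * f) := by
      rw [hf]; exact hx.succ (j := ⟨k, hk⟩)
    have hx1 := hx'.le
    simp +decide only [val_cell, Expr.val_add, Expr.val_sub, Expr.val_mul, Expr.val_var,
      Expr.val_get, Expr.val_one, Store.setVar, Function.update_apply, if_true, if_false, true_and,
      e1, e4, e5, e9, e10, hm, hf', I]
    refine ⟨by omega, by omega, fun y h4 h6 h11 => ?_, hx'⟩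
    simpa [h4, h6, h11] using hv y h4 h6 h11
  · rintro ρ ⟨hm, hv, hx⟩ - -
    exact hQ ρ hm hv hx

/-- The target level `h'` may equal `h`, when the keeping branch is dropped. Each column is read
before it is overwritten, and the flipped branch is written last, so in the description of array 2
the case `r = h'` takes precedence. -/
theorem flipCmd_wp {β N : ℕ} (w : List ℕ) (hβ : n + 1 ≤ β) (hN : n ≤ N) (σ : Store)
    (h1 : σ.var 1 = n) (hT : IsTable S (σ.mem 0)) {τ : Branch n} {h h' : ℕ} {x : Fin n}
    (h5 : σ.var 5 = h) (h8 : σ.var 8 = h') (h9 : σ.var 9 = x) (h10 : σ.var 10 = (τ.sol x).toNat)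
    (hτ : ∀ j : Fin n, σ.mem 1 (h * n + j) = (τ.sol j).toNat ∧
      σ.mem 2 (h * n + j) = if j ∈ τ.free then 1 else 0)
    (Q : Store → Prop)
    (hQ : ∀ ρ : Store, ρ.mem 0 = σ.mem 0 → ρ.mem 3 = σ.mem 3 →
      (∀ y, y ≠ 4 → y ≠ 7 → y ≠ 11 → y ≠ 12 → y ≠ 13 → ρ.var y = σ.var y) →
      Tracks (· ∈ (τ.flip S x).free) n (ρ.var 7) →
      (∀ r (j : Fin n), ρ.mem 1 (r * n + j) =
        if r = h' then ((τ.flip S x).sol j).toNat else σ.mem 1 (r * n + j)) →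
      (∀ r (j : Fin n), ρ.mem 2 (r * n + j) =
        if r = h' then if j ∈ (τ.flip S x).free then 1 else 0
        else if r = h then if j ∈ (τ.keep S x).free then 1 else 0
        else σ.mem 2 (r * n + j)) →
      (∀ j : Fin n, ρ.out j = ((τ.flip S x).sol j).toNat) → Q ρ) :
    flipCmd.wp w β N Q σ := by
  let I (k : ℕ) (ρ : Store) : Prop := ρ.mem 0 = σ.mem 0 ∧ ρ.mem 3 = σ.mem 3 ∧
    (∀ y, y ≠ 4 → y ≠ 7 → y ≠ 11 → y ≠ 12 → y ≠ 13 → ρ.var y = σ.var y) ∧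
    Tracks (· ∈ (τ.flip S x).free) k (ρ.var 7) ∧
    (∀ r (j : Fin n), ρ.mem 1 (r * n + j) = if (j : ℕ) < k ∧ r = h' then
      ((τ.flip S x).sol j).toNat else σ.mem 1 (r * n + j)) ∧
    (∀ r (j : Fin n), ρ.mem 2 (r * n + j) =
      if (j : ℕ) < k ∧ r = h' then if j ∈ (τ.flip S x).free then 1 else 0
      else if (j : ℕ) < k ∧ r = h then if j ∈ (τ.keep S x).free then 1 else 0
      else σ.mem 2 (r * n + j)) ∧
    (∀ j : Fin n, (j : ℕ) < k → ρ.out j = ((τ.flip S x).sol j).toNat)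
  simp only [flipCmd, track, Cmd.wp, Expr.val_zero]
  have e1 : (σ.setVar 7 0).var 1 = n := by simp [Store.setVar, h1]
  rw [e1]
  refine ⟨Nat.zero_le _, I, hN, ?_, ?_, ?_⟩
  · refine ⟨rfl, rfl, fun y h4 h7 h11 h12 h13 => ?_, Tracks.zero, ?_, ?_, ?_⟩
    · simp [Store.setVar, h4, h7]
    · simp [Store.setVar]
    · simp [Store.setVar]
    · simp
  · rintro k hk ρ ⟨hm0, hm3, hv, hx, hsol, hfree, hout⟩ e4 e1
    have e5 := (hv 5 (by decide) (by decide) (by decide) (by decide) (by decide)).trans h5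
    have e8 := (hv 8 (by decide) (by decide) (by decide) (by decide) (by decide)).trans h8
    have e9 := (hv 9 (by decide) (by decide) (by decide) (by decide) (by decide)).trans h9
    have e10 := (hv 10 (by decide) (by decide) (by decide) (by decide) (by decide)).trans h10
    -- Column `k` is still unwritten, so level `h` holds the old branch there even if `h' = h`.
    have hs : ρ.mem 1 (h * n + k) = (τ.sol ⟨k, hk⟩).toNat := by
      have := hsol h ⟨k, hk⟩
      simpa [(hτ ⟨k, hk⟩).1] using this
    have hF : ρ.mem 2 (h * n + k) = if (⟨k, hk⟩ : Fin n) ∈ τ.free then 1 else 0 := by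
      have := hfree h ⟨k, hk⟩
      simpa [(hτ ⟨k, hk⟩).2] using this
    obtain ⟨F, hF'⟩ : ∃ F, F = if (⟨k, hk⟩ : Fin n) ∈ τ.free then 1 else 0 := ⟨_, rfl⟩
    obtain ⟨s, hs'⟩ : ∃ s, s = (τ.sol ⟨k, hk⟩).toNat := ⟨_, rfl⟩
    obtain ⟨b, hb⟩ : ∃ b, b = (τ.sol x).toNat := ⟨_, rfl⟩
    obtain ⟨f, hf⟩ : ∃ f, f = if (⟨k, hk⟩ : Fin n) ∈ (τ.keep S x).free then 1 else 0 := ⟨_, rfl⟩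
    obtain ⟨g, hg⟩ : ∃ g, g = if (⟨k, hk⟩ : Fin n) ∈ (τ.flip S x).free then 1 else 0 := ⟨_, rfl⟩
    obtain ⟨t, ht⟩ : ∃ t, t = if Compat S x (!τ.sol x) ⟨k, hk⟩ (τ.sol ⟨k, hk⟩) then 1 else 0 :=
      ⟨_, rfl⟩
    obtain ⟨u, hu⟩ : ∃ u, u = ((τ.flip S x).sol ⟨k, hk⟩).toNat := ⟨_, rfl⟩
    have hf' : F * σ.mem 0 ((2 * x + b) * (2 * n) + (2 * k + (1 - s))) = f := by
      have := hT x ⟨k, hk⟩ (τ.sol x) (!τ.sol ⟨k, hk⟩)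
      simp only at this
      rw [hF', hs', hb, one_sub_toNat, this, ite_mul_ite_one, hf]
      simp only [keep, Finset.mem_filter]
    have hg' : F * (σ.mem 0 ((2 * x + (1 - b)) * (2 * n) + (2 * k + 0)) *
        σ.mem 0 ((2 * x + (1 - b)) * (2 * n) + (2 * k + 1))) = g := by
      have c1 := hT x ⟨k, hk⟩ (!τ.sol x) false
      have c2 := hT x ⟨k, hk⟩ (!τ.sol x) true
      simp only [Bool.toNat_false, Bool.toNat_true] at c1 c2
      rw [hF', hb, one_sub_toNat, c1, c2, ite_mul_ite_one, ite_mul_ite_one, hg]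
      simp only [Branch.flip, Finset.mem_filter]
    have ht' : σ.mem 0 ((2 * x + (1 - b)) * (2 * n) + (2 * k + s)) = t := by
      have := hT x ⟨k, hk⟩ (!τ.sol x) (τ.sol ⟨k, hk⟩)
      simp only at this
      rw [hb, hs', one_sub_toNat, this, ht]
    have hu' : s * t + (1 - s) * (1 - t) = u := by
      rw [hs', ht, toNat_select, hu]
      rfl
    rw [← hF'] at hF
    rw [← hs'] at hs
    rw [← hb] at e10
    have hF1 : F ≤ 1 := by rw [hF']; split_ifs <;> simp
    have hg1 : g ≤ 1 := by rw [hg]; split_ifs <;> simp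
    have hf1 : f ≤ 1 := by rw [hf]; split_ifs <;> simp
    have ht1 : t ≤ 1 := by rw [ht]; split_ifs <;> simp
    have hs1 : s ≤ 1 := by rw [hs']; exact Bool.toNat_le _
    have hu1 : u ≤ 1 := by rw [hu]; exact Bool.toNat_le _
    have hx' : Tracks (· ∈ (τ.flip S x).free) (k + 1) (ρ.var 7 * (1 - g) + (k + 1) * g) := by
      rw [hg]; exact hx.succ (j := ⟨k, hk⟩)
    have hx1 := hx'.le
    simp +decide only [val_cell, Expr.val_add, Expr.val_sub, Expr.val_mul, Expr.val_var,
      Expr.val_get, Expr.val_zero, Expr.val_one, Store.setVar, Store.setMem, Store.setOut,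
      Function.update_apply, if_true, if_false, true_and, false_and, e1, e4, e5, e8, e9, e10, hm0,
      hm3, hF, hs, hf', hg', ht', hu', I]
    refine ⟨by omega, by omega, by omega, by omega, by omega, by omega, by omega, by omega,
      by omega, by omega, fun y h4 h7 h11 h12 h13 => ?_, hx', fun r j => ?_, fun r j => ?_,
      fun j hj => ?_⟩
    · simpa [h4, h7, h11, h12, h13] using hv y h4 h7 h11 h12 h13
    · simp only [hsol, row_col_inj j.isLt hk]
      by_cases hj : (j : ℕ) = k
      · obtain rfl : j = ⟨k, hk⟩ := Fin.ext hj
        by_cases hr : r = h' <;> simp [hr, hu]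
      · have : (j : ℕ) < k + 1 ↔ (j : ℕ) < k := by omega
        simp only [hj, and_false, if_false, this]
    · simp only [hfree, row_col_inj j.isLt hk]
      by_cases hj : (j : ℕ) = k
      · obtain rfl : j = ⟨k, hk⟩ := Fin.ext hj
        by_cases hr : r = h' <;> by_cases hr' : r = h <;> simp [hr, hr', hf, hg]
      · have : (j : ℕ) < k + 1 ↔ (j : ℕ) < k := by omega
        simp only [hj, and_false, if_false, this]
    · by_cases hjk : (j : ℕ) = k
      · obtain rfl : j = ⟨k, hk⟩ := Fin.ext hjk
        simp [hu]
      · rw [if_neg hjk]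
        exact hout j (by omega)
  · rintro ρ ⟨hm0, hm3, hv, hx, hsol, hfree, hout⟩ - -
    refine hQ ρ hm0 hm3 hv hx (fun r j => ?_) (fun r j => ?_) fun j => hout j j.isLt
    · simpa only [j.isLt, true_and] using hsol r j
    · simpa only [j.isLt, true_and] using hfree r j

/-- The keeping branch is scanned first because its being empty or not decides the level at which
the flipped branch goes. -/
theorem stepCmd_wp {β N : ℕ} (w : List ℕ) (hβ : n + 3 ≤ β) (hN : n ≤ N) (σ : Store)
    {τ : Branch n} {st : List (Branch n)} (hσ : Ready S (τ :: st) σ) (hst : st.length ≤ n)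
    (Q : Store → Prop)
    (hQ : ∀ (ρ : Store) (x : Fin n), x ∈ τ.free → Ready S (τ.split S x st) ρ →
      (∀ j : Fin n, ρ.out j = ((τ.flip S x).sol j).toNat) → Q ρ) :
    stepCmd.wp w β N Q σ := by
  obtain ⟨h1, h5, hT, ⟨hτ, htr⟩, hne, hstack⟩ := hσ
  obtain ⟨x, hx3, hx⟩ : ∃ x : Fin n, σ.mem 3 st.length = x + 1 ∧ x ∈ τ.free := by
    rcases htr with ⟨-, h⟩ | h
    · exact absurd (Finset.eq_empty_of_forall_notMem fun j => h j j.isLt) hne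
    · exact h
  have hxn := x.isLt
  have hb1 := Bool.toNat_le (τ.sol x)
  have h5' : σ.var 5 - 1 = st.length := by simp [h5]
  simp +decide only [stepCmd, Cmd.wp, Expr.val_add, Expr.val_sub, Expr.val_mul, Expr.val_var,
    Expr.val_get, Expr.val_one, Store.setVar, Function.update_apply, if_true, if_false, h5', h1,
    hx3, Nat.add_sub_cancel, (hτ x).1]
  refine ⟨by omega, by omega, by omega, ?_⟩
  refine keepCmd_wp S (β := β) (τ := τ) (h := st.length) (x := x) w (by omega) hN _ ?_ ?_ ?_ ?_
    ?_ ?_ _ fun ρ hm hv hk => ?_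
  · simp [h1]
  · exact hT
  · simp
  · simp
  · simp
  · exact hτ
  have v1 := hv 1 (by decide) (by decide) (by decide)
  have v5 := hv 5 (by decide) (by decide) (by decide)
  have v9 := hv 9 (by decide) (by decide) (by decide)
  have v10 := hv 10 (by decide) (by decide) (by decide)
  simp +decide only [Function.update_apply, if_true, if_false, h1] at v1 v5 v9 v10 hm
  obtain ⟨h', hh'⟩ : ∃ h', h' = ((τ.keep S x).push st).length := ⟨_, rfl⟩
  have hl := Tracks.length_push st hk
  rw [← hh'] at hl
  have hk' := hk.le
  have hh1 : h' ≤ st.length + 1 := by omega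
  simp only [v5, ← hl]
  refine ⟨by omega, ?_⟩
  refine flipCmd_wp S (β := β) w (by omega) hN _ (by simp [v1]) (by rw [hm]; exact hT)
    (h := st.length) (h' := h') (τ := τ) (x := x) (by simp [v5]) (by simp) (by simp [v9])
    (by simp [v10]) (by rw [hm]; exact hτ) _ fun ρ' hm0 hm3 hv' hfl hsol hfree hout => ?_
  simp only [hm] at hm0 hm3 hsol hfree
  have u1 := hv' 1 (by decide) (by decide) (by decide) (by decide) (by decide)
  have u5 := hv' 5 (by decide) (by decide) (by decide) (by decide) (by decide)
  have u6 := hv' 6 (by decide) (by decide) (by decide) (by decide) (by decide)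
  have u8 := hv' 8 (by decide) (by decide) (by decide) (by decide) (by decide)
  simp +decide only [Function.update_apply, if_true, if_false, v1, v5] at u1 u5 u6 u8
  have hl' := Tracks.length_push ((τ.keep S x).push st) hfl
  rw [← hh'] at hl'
  have hfl' := hfl.le
  simp +decide only [u5, u6, u8, Store.setMem, ← hl']
  refine ⟨by omega, by omega, by omega, hQ _ x hx ⟨?_, ?_, ?_, ?_⟩ hout⟩
  · simpa using u1
  · simp [split]
  · simpa [hm0] using hT
  · have hbase : st.length ≤ h' := by omega
    rw [split]
    refine IsStack.push ?_ ⟨fun j => ?_, ?_⟩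
    · have hrest : ∀ l < st.length, l ≠ h' ∧ l ≠ st.length := fun l hl => by omega
      -- If the keeping branch is dropped, the flipped one reuses the level of `τ`; otherwise that
      -- level now holds the keeping branch. Lower levels are untouched in both cases.
      by_cases h0 : (τ.keep S x).free = ∅
      · rw [show (τ.keep S x).push st = st from if_pos h0]
        refine hstack.congr fun l hl => ⟨fun j => ?_, ?_⟩
        · simp [hsol, hfree, hrest l hl]
        · simp [hm3, hrest l hl]
      · have hp : (τ.keep S x).push st = τ.keep S x :: st := if_neg h0
        have hne : st.length ≠ h' := by simp [hh', hp]
        rw [hp]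
        refine ⟨⟨fun j => ?_, ?_⟩, h0, hstack.congr fun l hl => ⟨fun j => ?_, ?_⟩⟩
        · have hj : σ.mem 1 (st.length * n + j) = ((τ.keep S x).sol j).toNat := (hτ j).1
          simpa [hsol, hfree, hne] using hj
        · simpa [hne] using hk
        · simp [hsol, hfree, hrest l hl]
        · simp [hm3, hrest l hl]
    · simp [hsol, hfree, ← hh']
    · simpa [← hh'] using hfl

end RAM

namespace RAM

/-! ### Bounds of the cost -/

namespace Cmd

/-- The command has no loops. -/
def loopFree : Cmd → Bool
  | assign _ _ => true
  | store _ _ _ => true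
  | put _ _ => true
  | seq c d => c.loopFree && d.loopFree
  | loop _ _ _ => false

/-- The command has no nested loops. -/
def unnested : Cmd → Bool
  | assign _ _ => true
  | store _ _ _ => true
  | put _ _ => true
  | seq c d => c.unnested && d.unnested
  | loop _ _ c => c.loopFree

theorem cost_eq_of_loopFree {c : Cmd} (h : c.loopFree) (N : ℕ) : c.cost N = c.cost 0 := by
  induction c with
  | seq c d ihc ihd =>
    simp only [loopFree, Bool.and_eq_true] at h
    simp only [cost, ihc h.1, ihd h.2]
  | loop i b c ih => simp [loopFree] at h
  | _ => rfl

/-- Without nesting the cost is affine in the loop bound, with coefficients depending on the command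
alone. This is the source of the linear delay. -/
theorem cost_le_of_unnested {c : Cmd} (h : c.unnested) (N : ℕ) : c.cost N ≤ c.cost 1 * (N + 1) := by
  induction c with
  | seq c d ihc ihd =>
    simp only [unnested, Bool.and_eq_true] at h
    simp only [cost, add_mul]
    exact Nat.add_le_add (ihc h.1) (ihd h.2)
  | loop i b c ih =>
    simp only [cost, cost_eq_of_loopFree h N, cost_eq_of_loopFree h 1]
    nlinarith
  | _ => exact Nat.le_mul_of_pos_right _ (Nat.succ_pos N)

theorem exists_polynomial_cost (c : Cmd) : ∃ p : Polynomial ℕ, ∀ N, p.eval N = c.cost N := by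
  induction c with
  | assign x e => exact ⟨.C (e.len + 1), fun N => by simp [cost]⟩
  | store k a e => exact ⟨.C (a.len + (4 + (e.len + 1))), fun N => by simp [cost]⟩
  | put a e => exact ⟨.C (a.len + (e.len + 1)), fun N => by simp [cost]⟩
  | seq c d ihc ihd =>
    obtain ⟨p, hp⟩ := ihc
    obtain ⟨q, hq⟩ := ihd
    exact ⟨p + q, fun N => by simp [cost, hp, hq]⟩
  | loop i b c ih =>
    obtain ⟨p, hp⟩ := ih
    exact ⟨.C 3 + .X * (p + .C 5), fun N => by
      simp only [cost, Polynomial.eval_add, Polynomial.eval_mul, Polynomial.eval_C, Polynomial.eval_X,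
        hp]⟩

end Cmd

/-! ### Traces of the machine -/

/-- At time `t` the machine is in the configuration `c` and has made the outputs `O`; the registers
were bounded before. -/
structure Trace (P : Program) (w : List ℕ) (B t : ℕ) (c : Config) (O : List (ℕ × List ℕ)) :
    Prop where
  run : P.run w t = c
  outputs : P.outputs w t = O
  bdd : ∀ s < t, (P.run w s).Bdd B

theorem Program.outputs_succ (P : Program) (w : List ℕ) (t : ℕ) :
    P.outputs w (t + 1) = P.outputs w t ++
      (((P.next (P.run w t)).emit (P.run w t)).map fun u => (t, u)).toList := by
  unfold Program.outputs
  rw [List.range_succ, List.filterMap_append]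
  cases h : (P.next (P.run w t)).emit (P.run w t) <;> simp [h]

variable {P : Program} {w : List ℕ} {B : ℕ}

theorem Trace.silent {k : ℕ} {c c' : Config} (h : Silent P w B k c c') :
    ∀ {t : ℕ} {O : List (ℕ × List ℕ)}, Trace P w B t c O → Trace P w B (t + k) c' O := by
  induction h with
  | refl c => exact fun h => h
  | @step k c c' hB he h ih =>
    intro t O hT
    rw [← add_assoc, Nat.add_right_comm]
    refine ih ⟨?_, ?_, fun s hs => ?_⟩
    · rw [Program.run, hT.run]
    · rw [Program.outputs_succ, hT.run, he, hT.outputs]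
      simp
    · rcases Nat.lt_succ_iff_lt_or_eq.mp hs with hs | rfl
      · exact hT.bdd s hs
      · rwa [hT.run]

theorem Trace.output {t a : ℕ} {c : Config} {O : List (ℕ × List ℕ)} (hT : Trace P w B t c O)
    (hn : P.next c = .output a) (hB : c.Bdd B) :
    Trace P w B (t + 1) ⟨c.pc + 1, c.reg, c.out⟩
      (O ++ [(t, (List.range (c.reg a)).map c.out)]) := by
  refine ⟨?_, ?_, fun s hs => ?_⟩
  · rw [Program.run, hT.run, hn]
    rfl
  · rw [Program.outputs_succ, hT.run, hn, hT.outputs]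
    rfl
  · rcases Nat.lt_succ_iff_lt_or_eq.mp hs with hs | rfl
    · exact hT.bdd s hs
    · rwa [hT.run]

theorem map_range_eq_encodeVector {n : ℕ} {f : ℕ → ℕ} {v : Fin n → Bool}
    (h : ∀ j : Fin n, f j = (v j).toNat) : (List.range n).map f = encodeVector v := by
  refine List.ext_getElem (by simp [encodeVector]) fun i h1 h2 => ?_
  simp only [List.length_map, List.length_range] at h1
  simpa [encodeVector] using h ⟨i, h1⟩

theorem encodeVector_injective {n : ℕ} :
    Function.Injective (encodeVector : (Fin n → Bool) → List ℕ) := by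
  intro u v h
  have h' := List.ofFn_injective h
  funext j
  have := congrFun h' j
  cases hu : u j <;> cases hv : v j <;> simp_all

/-! ### The complete program -/

/-- The program that runs the precomputation `init`, stops if `R 0` is zero, and otherwise
alternates outputs with `step` until `R 5` is zero. -/
def assemble (init step : Cmd) : Program :=
  init.compile 0 ++ ([.jumpZero 0 (init.len + (4 + step.len)), .output 1,
    .jumpZero 5 (init.len + (4 + step.len))] ++
    (step.compile (init.len + 3) ++ [.jump (init.len + 1), .halt]))

variable (init step : Cmd)

theorem initCode_codeAt : CodeAt (assemble init step) 0 (init.compile 0) :=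
  CodeAt.left (js := _) ⟨[], [], by rw [List.nil_append, List.append_nil]; rfl, rfl⟩

theorem testCode_codeAt : CodeAt (assemble init step) init.len
    [.jumpZero 0 (init.len + (4 + step.len)), .output 1,
      .jumpZero 5 (init.len + (4 + step.len))] :=
  ⟨init.compile 0, step.compile (init.len + 3) ++ [.jump (init.len + 1), .halt],
    by rw [assemble, List.append_assoc], Cmd.length_compile _ _⟩

theorem stepCode_codeAt : CodeAt (assemble init step) (init.len + 3)
    (step.compile (init.len + 3) ++ [.jump (init.len + 1), .halt]) :=
  ⟨init.compile 0 ++ [.jumpZero 0 (init.len + (4 + step.len)), .output 1,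
      .jumpZero 5 (init.len + (4 + step.len))], [],
    by rw [assemble, List.append_nil, List.append_assoc], by
      rw [List.length_append, Cmd.length_compile]; rfl⟩

theorem endCode_codeAt : CodeAt (assemble init step) (init.len + 3 + step.len)
    [.jump (init.len + 1), .halt] := by
  have h := (stepCode_codeAt init step).right
  rwa [Cmd.length_compile] at h

theorem next_end (reg out : ℕ → ℕ) :
    (assemble init step).next ⟨init.len + (4 + step.len), reg, out⟩ = .halt := by
  have h := (endCode_codeAt init step).tail.next reg out
  rwa [show init.len + 3 + step.len + 1 = init.len + (4 + step.len) by omega] at h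

open Branch

variable {init step}

variable {m n : ℕ} {S : Fin m → Fin n → Bool}

/-- The main loop, from an output instruction on: it outputs the current solution and an enumeration
of the solutions of the stack. -/
theorem mainLoop {β : ℕ} (hwf : step.wf 200)
    (hstep : ∀ (σ : Store) (τ : Branch n) (st : List (Branch n)), Ready S (τ :: st) σ →
      st.length ≤ n → step.wp (encodeInstance S) β n (fun ρ => ∃ x ∈ τ.free,
        Ready S (τ.split S x st) ρ ∧ ∀ j : Fin n, ρ.out j = ((τ.flip S x).sol j).toNat) σ)
     (hw : ∀ a, (encodeInstance S).getD a 0 ≤ β) (hB : (β + 2) ^ 200 ≤ B) (st : List (Branch n)) :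
    ∀ (t : ℕ) (σ : Store) (reg : ℕ → ℕ) (v : Fin n → Bool) (O : List (ℕ × List ℕ)),
      Trace (assemble init step) (encodeInstance S) B t ⟨init.len + 1, reg, σ.out⟩ O →
      Rel B σ reg → σ.Bdd β → Ready S st σ → Ok S st → (∀ j : Fin n, σ.out j = (v j).toNat) →
      ∃ (T : ℕ) (L : List (Fin n → Bool)) (ts : List (ℕ × List ℕ)) (reg' out' : ℕ → ℕ),
        Lists S st L ∧
        Trace (assemble init step) (encodeInstance S) B T ⟨init.len + (4 + step.len), reg', out'⟩
          (O ++ (t, encodeVector v) :: ts) ∧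
        ts.map Prod.snd = L.map encodeVector ∧ Config.Bdd B ⟨0, reg', out'⟩ ∧
        (t :: (ts.map Prod.fst ++ [T])).IsChain fun t t' => t' ≤ t + (step.cost n + 3) := by
  -- A split can lengthen the stack, so the induction is on the weight.
  induction hW : weight st using Nat.strong_induction_on generalizing st with
  | _ W ih =>
    subst hW
    intro t σ reg v O hT hR hσ hst hok hv
    have hβB : β ≤ B := by
      have : β + 2 ≤ B := (Nat.le_self_pow (by decide) _).trans hB
      omega
    have hout : ∀ a, σ.out a ≤ B := fun a => (hσ.out a).trans hβB
    have h1 := hT.output ((testCode_codeAt init step).tail.next reg σ.out) ⟨hR.le, hout⟩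
    simp only [hR.var 1 (by decide), hst.size, map_range_eq_encodeVector hv] at h1
    have s2 := Silent.one (w := encodeInstance S) _ ((testCode_codeAt init step).tail.tail.next reg σ.out)
      ⟨hR.le, hout⟩ rfl
    simp only [Instr.exec, hR.var 5 (by decide), hst.height] at s2
    cases st with
    | nil =>
      refine ⟨t + 1 + 1, [], [], reg, σ.out, .nil, ?_, rfl, ⟨hR.le, hout⟩, ?_⟩
      · exact Trace.silent s2 h1
      · simp
    | cons τ st =>
      have hlen : st.length ≤ n := by
        have := hok.2.1
        omega
      obtain ⟨k, hk, reg', ρ, s3, ⟨x, hx, hready, hout'⟩, hρ, hR'⟩ :=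
        Cmd.compile_sound (N := n) hw (by decide) hB step
          (fun ρ => ∃ x ∈ τ.free, Ready S (τ.split S x st) ρ ∧
            ∀ j : Fin n, ρ.out j = ((τ.flip S x).sol j).toNat) σ (init.len + 3) reg hwf
          (stepCode_codeAt init step).left (hstep σ τ st hst hlen) hσ hR
      have s4 := Silent.one (w := encodeInstance S) _ ((endCode_codeAt init step).next reg' ρ.out)
        ⟨hR'.le, fun a => (hρ.out a).trans hβB⟩ rfl
      simp only [Instr.exec] at s4
      simp only [List.length_cons, Nat.succ_ne_zero, if_false] at s2
      have h4 := Trace.silent (s2.trans (s3.trans s4)) h1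
      obtain ⟨T, L, ts, reg'', out'', hL, hT', hts, hbdd, hchain⟩ :=
        ih _ (weight_split_lt st hx) _ rfl _ ρ reg' _ _ h4 hR' hρ hready (hok.split hx) hout'
      refine ⟨T, (τ.flip S x).sol :: L,
        (t + 1 + (1 + (k + 1)), encodeVector (τ.flip S x).sol) :: ts, reg'', out'', .step hx hL, ?_, ?_,
        hbdd, ?_⟩
      · rwa [List.append_assoc, List.singleton_append] at hT'
      · rw [List.map_cons, List.map_cons, hts]
      · rw [List.map_cons, List.cons_append]
        -- Besides the step command, the output instruction, the test of the height and the jump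
        -- back take one step each, which is the 3 in the delay.
        exact List.isChain_cons_cons.mpr ⟨by omega, hchain⟩


theorem assemble_enumerates (hwf : step.wf 200) (hiwf : init.wf 200)
    (hw : ∀ a, (encodeInstance S).getD a 0 ≤ m + n + 3)
    (hinit : init.wp (encodeInstance S) (m + n + 3) (m + n)
      (fun τ => τ.var 0 = m ∧ τ.var 1 = n ∧ ∀ hm : 0 < m,
        Ready S ((start S ⟨0, hm⟩).push []) τ ∧ ∀ j : Fin n, τ.out j = (S ⟨0, hm⟩ j).toNat)
      ⟨fun _ => 0, fun _ _ => 0, fun _ => 0⟩)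
    (hstep : ∀ (σ : Store) (τ : Branch n) (st : List (Branch n)), Ready S (τ :: st) σ →
      st.length ≤ n → step.wp (encodeInstance S) (m + n + 3) n (fun ρ => ∃ x ∈ τ.free,
        Ready S (τ.split S x st) ρ ∧ ∀ j : Fin n, ρ.out j = ((τ.flip S x).sol j).toNat) σ)
    {delay : ℕ} (hdelay : step.cost n + 3 ≤ delay) :
    (assemble init step).Enumerates (encodeInstance S) (enumClosure D₂ S)
      (init.cost (m + n) + 1) delay ((m + n + 3 + 2) ^ 200) := by
  obtain ⟨B, hB⟩ : ∃ B, B = (m + n + 3 + 2) ^ 200 := ⟨_, rfl⟩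
  rw [← hB]
  have hβB : m + n + 3 ≤ B := by
    have : m + n + 3 + 2 ≤ B := by rw [hB]; exact Nat.le_self_pow (by decide) _
    omega
  obtain ⟨k, hk, reg, σ, s1, ⟨h0, h1, hσ⟩, hbdd, hR⟩ :=
    Cmd.compile_sound (P := (assemble init step)) (N := m + n) (β := m + n + 3) hw (by decide) hB.ge init
      (fun τ => τ.var 0 = m ∧ τ.var 1 = n ∧ ∀ hm : 0 < m,
        Ready S ((start S ⟨0, hm⟩).push []) τ ∧ ∀ j : Fin n, τ.out j = (S ⟨0, hm⟩ j).toNat)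
      ⟨fun _ => 0, fun _ _ => 0, fun _ => 0⟩ 0 (fun _ => 0)
      hiwf (initCode_codeAt init step) hinit
      ⟨fun _ => Nat.zero_le _, fun _ _ => Nat.zero_le _, fun _ => Nat.zero_le _⟩
      ⟨fun _ _ => rfl, fun _ _ _ => rfl, fun _ => Nat.zero_le _⟩
  have hout : ∀ a, σ.out a ≤ B := fun a => (hbdd.out a).trans hβB
  have t0 : Trace (assemble init step) (encodeInstance S) B 0 ⟨0, fun _ => 0, fun _ => 0⟩ [] :=
    ⟨rfl, rfl, fun s hs => absurd hs (Nat.not_lt_zero s)⟩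
  have t1 := Trace.silent s1 t0
  rw [Nat.zero_add, Nat.zero_add] at t1
  have s2 := Silent.one (w := encodeInstance S) _ ((testCode_codeAt init step).next reg σ.out)
    ⟨hR.le, hout⟩ rfl
  simp only [Instr.exec, hR.var 0 (by decide), h0] at s2
  have t2 := Trace.silent s2 t1
  -- the run is bounded up to its end
  have bdd_of : ∀ {T : ℕ} {c : Config} {O : List (ℕ × List ℕ)},
      Trace (assemble init step) (encodeInstance S) B T c O → Config.Bdd B c →
      ∀ t ≤ T, ∀ a, ((assemble init step).run (encodeInstance S) t).reg a ≤ B ∧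
        ((assemble init step).run (encodeInstance S) t).out a ≤ B := by
    intro T c O hT hc t ht a
    rcases ht.lt_or_eq with ht | rfl
    · exact ⟨(hT.bdd t ht).1 a, (hT.bdd t ht).2 a⟩
    · rw [hT.run]
      exact ⟨hc.1 a, hc.2 a⟩
  rcases Nat.eq_zero_or_pos m with hm | hm
  -- With no input vectors the closure is empty, and the machine jumps to `halt` before any output.
  · rw [if_pos hm] at t2
    refine ⟨k + 1, ?_, ?_, ?_, ?_, ?_, bdd_of t2 ⟨hR.le, hout⟩⟩
    · rw [t2.run]
      exact next_end _ _ _ _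
    · simp [t2.outputs]
    · subst hm
      simp [t2.outputs, enumClosure, Cl_empty]
    · simp [t2.outputs]
      omega
    · simp [t2.outputs]
  · rw [if_neg hm.ne'] at t2
    obtain ⟨hready, hfirst⟩ := hσ hm
    obtain ⟨T, L, ts, reg', out', hL, hT, hts, hbdd', hchain⟩ :=
      mainLoop hwf hstep hw hB.ge _ _ σ reg _ _ t2 hR hbdd hready (start_ok _) hfirst
    rw [List.nil_append] at hT
    obtain ⟨hnd, hmem⟩ := hL.start_spec
    have hsnd : ((k + 1, encodeVector (S ⟨0, hm⟩)) :: ts).map Prod.snd =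
        (S ⟨0, hm⟩ :: L).map encodeVector := by
      rw [List.map_cons, List.map_cons, hts]
    refine ⟨T, ?_, ?_, ?_, ?_, ?_, bdd_of hT hbdd'⟩
    · rw [hT.run]
      exact next_end _ _ _ _
    · rw [hT.outputs, hsnd]
      exact hnd.map encodeVector_injective
    · intro u
      rw [hT.outputs, hsnd, List.mem_map, enumClosure, Cl_eq_pairClosure hm]
      simp only [hmem]
      rfl
    · simp [hT.outputs]
      omega
    · rw [hT.outputs]
      exact hchain.imp fun a b h => h.trans (by omega)


end RAM

/-! ### The concrete program and its bounds. -/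

namespace RAM

/-- The precomputation. -/
def initCmd : Cmd := .seq tableCmd startCmd

theorem initCmd_wf : initCmd.wf 200 = true := by
  rw [initCmd, Cmd.wf, tableCmd_wf, startCmd_wf]
  rfl

/-- The program enumerating the closure by the majority. -/
def program : Program := assemble initCmd stepCmd

theorem stepCmd_cost_le (n : ℕ) : stepCmd.cost n + 3 ≤ (stepCmd.cost 1 + 3) * (n + 1) := by
  have h := Cmd.cost_le_of_unnested (c := stepCmd) (by decide) n
  -- The costs are made opaque, so that only the inequality between them remains.
  generalize stepCmd.cost n = a at *
  generalize stepCmd.cost 1 = b at *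
  nlinarith

theorem program_enumerates (p : Polynomial ℕ) (hp : ∀ N, p.eval N = initCmd.cost N) (m n : ℕ)
    (S : Fin m → Fin n → Bool) : program.Enumerates (encodeInstance S) (enumClosure D₂ S)
      ((p + .C 1).eval (m + n)) ((stepCmd.cost 1 + 3) * (n + 1))
      (((.X + .C 5) ^ 200 : Polynomial ℕ).eval (m + n)) := by
  have hpre : (p + .C 1).eval (m + n) = initCmd.cost (m + n) + 1 := by
    rw [Polynomial.eval_add, Polynomial.eval_C, hp]
  have hword : ((.X + .C 5) ^ 200 : Polynomial ℕ).eval (m + n) = (m + n + 3 + 2) ^ 200 := by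
    rw [Polynomial.eval_pow, Polynomial.eval_add, Polynomial.eval_C, Polynomial.eval_X]
  have hw : ∀ a, (encodeInstance S).getD a 0 ≤ m + n + 3 := fun a =>
    (encodeInstance_getD_le S a).trans (by omega)
  rw [hpre, hword]
  exact assemble_enumerates stepCmd_wf initCmd_wf hw
    (tableCmd_wp S (by omega) le_rfl _ (fun _ _ => rfl) _ fun τ h0 h1 hT =>
      startCmd_wp S hw (by omega) le_rfl τ h0 h1 hT _ fun ρ h0 h1 h => ⟨h0, h1, h⟩)
    (fun σ τ st hσ hst => stepCmd_wp S _ (by omega) le_rfl σ hσ hst _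
      fun ρ x hx h1 h2 => ⟨x, hx, h1, h2⟩)
    (stepCmd_cost_le n)

end RAM

theorem mainTheorem9 :
    (∃ (P : RAM.Program) (pre word : Polynomial ℕ) (C : ℕ),
      ∀ (m n : ℕ) (S : Fin m → Fin n → Bool),
        P.Enumerates (encodeInstance S) (enumClosure D₂ S)
          (pre.eval (m + n)) (C * (n + 1)) (word.eval (m + n))) ∧
    ∀ (m n : ℕ) (S : Fin m → Fin n → Bool), ∃ φ : Std.Sat.CNF (Fin n),
      (∀ c ∈ φ.clauses, c.length ≤ 2) ∧ Cl D₂ (Set.range S) = {v | φ.eval v = true} := by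
  obtain ⟨p, hp⟩ := RAM.initCmd.exists_polynomial_cost
  exact ⟨⟨RAM.program, _, _, _, RAM.program_enumerates p hp⟩, exists_twoCNF⟩
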